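/- Let $N,K,T,M$ be integers with $K\ge 1$, $1\le T<N$, $M\ge 2$, and suppose that $r=\frac{NK-N+T}{K}$ is an integer. There is a $q_0=q_0(N,K,T,M)$ such that for every finite field $\mathbb F$ with $|\mathbb F|\ge q_0$ and every linear $(N,K)$-MDS code over $\mathbb F$ the following holds. *Setting.* $M$ independent uniform messages $W^1,\dots,W^M\in\mathbb F^{L}$, $L=K\ell$, are stored on $N$ servers with the code: writing $W^m$ as $K$ blocks in $\mathbb F^{\ell}$ and $G$ for a generator matrix, server $i$ stores $D_i=(\sum_k G_{ki}W^m_k)_{m\le M}\in\mathbb F^{M\ell}$ and answers a query $x\in\mathbb F^{M\ell}$ with $\langle D_i,x\rangle$. Let $\mathbb V_m\subseteq\mathbb F^{M\ell}$ be the space of queries supported on message $m$. A scheme consists, for each desired index $\theta$, of random families $Q^\theta_i$ of queries to the servers $i=1,\dots,N$; it is an *$(N,K,T,M)$-PIR scheme* if $H(W^\theta\mid \text{answers},\text{queries})=0$ for every $\theta$ (correctness), and $I((Q^\theta_i)_{i\in J};\theta)=0$, with $\theta$ uniform and independent of the user's randomness, for every set $J$ of $T$ servers ($T$-privacy). Its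 *rate* is $L$ divided by the number of queries. *One-shot schemes.* An $(N,K,T,M)$-one-shot scheme of codimension $r$ sends the query $q_i$ to server $i$ for $i\le r$ and $q_i+a^\theta_i$ for $i>r$, where the $q_i\in\mathbb F^{M\ell}$ are random, $a^\theta_i\in\mathbb V_\theta$, any $T$ of the queries are independent and uniform on $\mathbb F^{M\ell}$, the responses $\langle D_i,a^\theta_i\rangle$ ($i>r$) are linearly independent, and for every $i>r$ there is a decoding equation $\langle D_i,q_i\rangle=\sum_{j\le r}\alpha^i_j\langle D_j,q_j\rangle$ with fixed coefficients. *Refining and lifting.* The symbolic matrices are $S_2=(1,\dots,1,2,\dots,2)$ ($r$ ones, $N-r$ twos), and $S_{m+1}$ consists of $S_m,\sigma S_m,\dots,\sigma^{r-1}S_m$ ($\sigma$ the cyclic shift of the columns to the left), one below the other, followed by one row for each entry $m$ of $S_m$; that row is $0$ in the $r$ columns containing the shifted copies of this entry, and $m+1$ in the other columns. The decoding groups, with one entry in each column, are: the row of $S_2$; the copies, under shifting, of the groups of $S_m$; and each new row together with the $r$ copies of its entry $m$. Thus a group has $r$ entries of some value $k$ and $N-r$ entries of value $k+1$. A scheme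 is obtained by refining and lifting a one-shot scheme, in $c$ rounds, if in each round every entry $k\ne0$ in column $i$ of $S_M$ stands for one query to server $i$ in $\bigoplus_{m\in S}\mathbb V_m$ for each $k$-subset $S$ of the messages; the components of all queries that concern the desired message $\theta$ have linearly independent responses; and in each round, for each decoding group with values $k,k+1$ and each $k$-set $S\not\ni\theta$, the $N$-tuple formed by the queries for $S$ (at the entries $k$) and by the $S$-parts of the queries for $S\cup\{\theta\}$ (at the entries $k+1$) is one of the values that the noise $(q_1,\dots,q_N)$ of the one-shot scheme takes with positive probability, so that it inherits its decoding equations. *Claim.* For some $\ell$ and $c$ there are an $(N,K,T,M)$-one-shot scheme of codimension $r=\frac{NK-N+T}{K}$ (the codimension of the scheme of Theorem 3 of Tajeddine et al.) and an $(N,K,T,M)$-PIR scheme $\mathcal Q$, obtained from it by refining and lifting, whose rate is $$R_{\mathcal Q}=\frac{(N-T)\,(NK)^{M-1}}{(NK)^M-(NK-N+T)^M}.$$ -/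

import Mathlib

universe u

namespace PIR

open Classical in
/-- The probability `P(X = x)` when the finite sample space `Ω` carries the weights `p`. -/
noncomputable def law {Ω α : Type*} [Fintype Ω] (p : Ω → ℝ) (X : Ω → α) (x : α) : ℝ :=
  ∑ ω, if X ω = x then p ω else 0

/-- Shannon entropy `H(X)` (in nats) of a random variable with finitely many values. -/
noncomputable def entropy {Ω α : Type*} [Fintype Ω] [Fintype α] (p : Ω → ℝ) (X : Ω → α) : ℝ :=
  ∑ x, Real.negMulLog (law p X x)

/-- Conditional entropy `H(X | Y) = H(X, Y) - H(Y)`. -/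
noncomputable def condEntropy {Ω α β : Type*} [Fintype Ω] [Fintype α] [Fintype β]
    (p : Ω → ℝ) (X : Ω → α) (Y : Ω → β) : ℝ :=
  entropy p (fun ω => (X ω, Y ω)) - entropy p Y

/-- Mutual information `I(X ; Y) = H(X) + H(Y) - H(X, Y)`. -/
noncomputable def mutualInfo {Ω α β : Type*} [Fintype Ω] [Fintype α] [Fintype β]
    (p : Ω → ℝ) (X : Ω → α) (Y : Ω → β) : ℝ :=
  entropy p X + entropy p Y - entropy p (fun ω => (X ω, Y ω))

/-- `G` generates an `(N, K)`-MDS code: any `K` columns (servers) determine the message. -/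
def IsMDS {F : Type*} [Field F] {K N : ℕ} (G : Matrix (Fin K) (Fin N) F) : Prop :=
  K ≤ N ∧ ∀ s : Fin K ↪ Fin N, IsUnit (G.submatrix id s).det

/-- `M` messages of `L = K * ℓ` symbols each, a message being cut into `K` blocks of length `ℓ`. -/
abbrev Messages (F : Type*) (K M ℓ : ℕ) : Type _ := Fin M → Fin K → Fin ℓ → F

/-- Linear queries, i.e. vectors of length `M * L / K = M * ℓ`, grouped by message. -/
abbrev Query (F : Type*) (M ℓ : ℕ) : Type _ := Fin M → Fin ℓ → F

/-- The data `D_i` stored on server `i`. -/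
def stored {F : Type*} [Field F] {K N M ℓ : ℕ} (G : Matrix (Fin K) (Fin N) F)
    (W : Messages F K M ℓ) (i : Fin N) : Query F M ℓ :=
  fun m j => ∑ k, G k i * W m k j

/-- The answer `⟨D_i, q⟩` of server `i` to the query `q`. -/
def response {F : Type*} [Field F] {K N M ℓ : ℕ} (G : Matrix (Fin K) (Fin N) F)
    (W : Messages F K M ℓ) (i : Fin N) (q : Query F M ℓ) : F :=
  ∑ m, ∑ j, stored G W i m j * q m j

/-- The part of a query that concerns the messages in `S`. -/
def restrictTo {F : Type*} [Field F] {M ℓ : ℕ} (S : Finset (Fin M)) (q : Query F M ℓ) :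
    Query F M ℓ :=
  fun m => if m ∈ S then q m else 0

/-- A (linear, randomized) scheme. The user who wants message `θ` sends server `i` the queries
`query θ ω i x`, with `x` in the finite index type `P i`; `ω` is the private randomness. -/
structure Scheme (F : Type u) [Field F] (M ℓ : ℕ) {N : ℕ} (P : Fin N → Type) where
  Ω : Type u
  [fintypeΩ : Fintype Ω]
  weight : Ω → ℝ
  weight_nonneg : ∀ ω, 0 ≤ weight ω
  weight_sum : ∑ ω, weight ω = 1
  query : Fin M → Ω → (i : Fin N) → P i → Query F M ℓ

attribute [instance] Scheme.fintypeΩ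

namespace Scheme

variable {F : Type u} [Field F] {K N M ℓ : ℕ} {P : Fin N → Type}

/-- All the answers received by a user who wants message `θ`. -/
def answers (Q : Scheme F M ℓ P) (G : Matrix (Fin K) (Fin N) F) (θ : Fin M)
    (W : Messages F K M ℓ) (ω : Q.Ω) : (i : Fin N) → P i → F :=
  fun i x => response G W i (Q.query θ ω i x)

/-- Messages uniform and independent, and independent of the user's randomness. -/
noncomputable def jointWeight [Fintype F] (Q : Scheme F M ℓ P) (K : ℕ)
    (s : Messages F K M ℓ × Q.Ω) : ℝ :=
  (Fintype.card (Messages F K M ℓ) : ℝ)⁻¹ * Q.weight s.2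

open Classical in
/-- Correctness: `H(W^θ | answers) = 0` for every desired message; the user knows the queries
that were sent. -/
def Correct [Fintype F] [∀ i, Fintype (P i)] (Q : Scheme F M ℓ P)
    (G : Matrix (Fin K) (Fin N) F) : Prop :=
  ∀ θ : Fin M, condEntropy (Q.jointWeight K) (fun s => s.1 θ)
    (fun s => (Q.answers G θ s.1 s.2, Q.query θ s.2)) = 0

/-- The desired index is uniform and independent of the user's randomness. -/
noncomputable def indexWeight (Q : Scheme F M ℓ P) (s : Fin M × Q.Ω) : ℝ :=
  (M : ℝ)⁻¹ * Q.weight s.2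

open Classical in
/-- `T`-privacy: the queries sent to any `T` servers have zero mutual information with the index
of the desired message. -/
def Private [Fintype F] [∀ i, Fintype (P i)] (Q : Scheme F M ℓ P) (T : ℕ) : Prop :=
  ∀ J : Finset (Fin N), J.card = T →
    mutualInfo Q.indexWeight (fun s => fun i : J => Q.query s.1 s.2 i) (fun s => s.1) = 0

/-- The rate: message length divided by the number of queries. -/
noncomputable def rate [∀ i, Fintype (P i)] (_Q : Scheme F M ℓ P) (K : ℕ) : ℝ :=
  ((K * ℓ : ℕ) : ℝ) / ((∑ i, Fintype.card (P i) : ℕ) : ℝ)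

end Scheme

/-- `Q` is an `(N, K, T, M)`-PIR scheme for the data stored with the code `G`. -/
def IsPIRScheme {F : Type u} [Field F] [Fintype F] {K N M ℓ : ℕ} {P : Fin N → Type}
    [∀ i, Fintype (P i)] (G : Matrix (Fin K) (Fin N) F) (T : ℕ) (Q : Scheme F M ℓ P) : Prop :=
  IsMDS G ∧ Q.Correct G ∧ Q.Private T

/-- An `(N, K, T, M)`-one-shot scheme of codimension `r`. Server `i` receives the noise query
`q ω i` if `i < r`, and the mixed query `q ω i + a θ i` if `r ≤ i` (servers are numbered from `0`);
`θ` is the desired message. -/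
structure OneShotScheme {F : Type u} [Field F] [Fintype F] {K N : ℕ}
    (G : Matrix (Fin K) (Fin N) F) (T M r ℓ : ℕ) where
  Ω : Type u
  [fintypeΩ : Fintype Ω]
  weight : Ω → ℝ
  weight_nonneg : ∀ ω, 0 ≤ weight ω
  weight_sum : ∑ ω, weight ω = 1
  q : Ω → Fin N → Query F M ℓ
  a : Fin M → Fin N → Query F M ℓ
  /-- the first `r` servers receive noise only -/
  a_noise : ∀ (θ : Fin M) (i : Fin N), (i : ℕ) < r → a θ i = 0
  /-- the `a`'s query the desired message only -/
  a_mem : ∀ (θ : Fin M) (i : Fin N) (m : Fin M), m ≠ θ → a θ i m = 0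
  /-- any `T` queries are independent and uniformly distributed -/
  uniform : ∀ (θ : Fin M) (J : Finset (Fin N)), J.card = T → ∀ y : J → Query F M ℓ,
    law weight (fun ω (i : J) => q ω i + a θ i) y =
      ((Fintype.card (Query F M ℓ) : ℝ) ^ T)⁻¹
  /-- the responses to the `a`'s are linearly independent, as functions of the messages -/
  independent : ∀ θ : Fin M, LinearIndependent F
    (fun (i : {i : Fin N // r ≤ (i : ℕ)}) (W : Messages F K M ℓ) => response G W i (a θ i))
  /-- the coefficients of the decoding equations -/
  coeff : Fin N → Fin N → F
  /-- the responses to the last noise terms are combinations of the first `r` ones -/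
  decoding : ∀ ω, 0 < weight ω → ∀ (W : Messages F K M ℓ) (i : Fin N), r ≤ (i : ℕ) →
    response G W i (q ω i) =
      ∑ j ∈ Finset.univ.filter (fun j : Fin N => (j : ℕ) < r), coeff i j * response G W j (q ω j)

attribute [instance] OneShotScheme.fintypeΩ

/-- The server `t` places after server `i`, cyclically. -/
def cyc {N : ℕ} (i : Fin N) (t : ℕ) : Fin N := ⟨(i + t) % N, Nat.mod_lt _ i.pos⟩

/-- The number of cyclic steps to the left that lead from column `j` to column `i`. -/
def stepsLeft {N : ℕ} (i j : Fin N) : ℕ := (j + (N - i)) % N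

/-- A matrix over `ℕ` with `N` columns, given by the list of its rows. -/
abbrev SymMatrix (N : ℕ) : Type := List (Fin N → ℕ)

/-- The matrix shifted cyclically by `t` columns to the left. -/
def shiftLeft {N : ℕ} (t : ℕ) (S : SymMatrix N) : SymMatrix N :=
  S.map fun row i => row (cyc i t)

/-- The positions (row, column) of the entries of value `k`, in lexicographic order. -/
def entriesOf {N : ℕ} (k : ℕ) (S : SymMatrix N) : List (ℕ × Fin N) :=
  (List.product (List.range S.length) (List.finRange N)).filter
    fun b => S.getD b.1 0 b.2 = k

/-- The lifting operation. Below `r` successive shifts of `S` there is one row for each entry `b` of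
value `M` in `S`: it is `0` in the `r` columns that contain a copy of `b`, and `M + 1` in the
others. -/
def lift {N : ℕ} (M r : ℕ) (S : SymMatrix N) : SymMatrix N :=
  (List.range r).flatMap (fun t => shiftLeft t S) ++
    (entriesOf M S).map fun b i => if stepsLeft i b.2 < r then 0 else M + 1

/-- The symbolic matrix `S_M` for `N` servers and codimension `r`, starting from
`S_2 = (1, …, 1, 2, …, 2)` with `r` ones and `N - r` twos (nothing is defined for `M < 2`). -/
def symbolicMatrix (N r : ℕ) : ℕ → SymMatrix N
  | 0 => []
  | 1 => []
  | 2 => [fun i => if (i : ℕ) < r then 1 else 2]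
  | M + 3 => lift (M + 2) r (symbolicMatrix N r (M + 2))

/-- The decoding groups of the symbolic matrix. A group `(k, g)` has one entry in each column `i`,
in row `g i`: `r` of them have value `k` and the other `N - r` have value `k + 1`. The entries of
value `k` supply the noise that hides the desired message in those of value `k + 1`.
In `S_2` the only row is a group. Under lifting, groups are shifted with the matrix, and each new row
forms a group with the `r` copies of the entry to which it belongs. -/
def groups (N r : ℕ) : ℕ → List (ℕ × (Fin N → ℕ))
  | 0 => []
  | 1 => []
  | 2 => [(1, fun _ => 0)]
  | M + 3 =>
    let S := symbolicMatrix N r (M + 2)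
    (List.range r).flatMap (fun t => (groups N r (M + 2)).map
      fun g => (g.1, fun i => t * S.length + g.2 (cyc i t))) ++
    (entriesOf (M + 2) S).zipIdx.map fun bn => (M + 2, fun i =>
      if stepsLeft i bn.1.2 < r then bn.1.1 + stepsLeft i bn.1.2 * S.length
      else r * S.length + bn.2)

/-- The query structure of the symbolic matrix, used for `c` rounds: in each round, an entry `k` in
column `i` stands for one `k`-query to server `i` for every set of `k` messages. An index is a triple
(round, row, set of messages). -/
abbrev LiftIndex (N r M c : ℕ) (i : Fin N) : Type :=
  {p : Fin c × Fin (symbolicMatrix N r M).length × Finset (Fin M) //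
    p.2.2.Nonempty ∧ p.2.2.card = (symbolicMatrix N r M).get p.2.1 i}

/-- `Q` is obtained by refining and lifting the one-shot scheme `O` (in `c` rounds). -/
structure IsRefinedLift {F : Type u} [Field F] [Fintype F] {K N T M r ℓ c : ℕ}
    {G : Matrix (Fin K) (Fin N) F} (O : OneShotScheme G T M r ℓ)
    (Q : Scheme F M ℓ (LiftIndex N r M c)) : Prop where
  /-- a query whose index carries the set `S` is a sum of queries to the messages in `S` -/
  structured : ∀ (θ : Fin M) (ω : Q.Ω), 0 < Q.weight ω →
    ∀ (i : Fin N) (x : LiftIndex N r M c i), ∀ m ∉ x.1.2.2, Q.query θ ω i x m = 0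
  /-- the components that query the desired message have linearly independent responses -/
  independent : ∀ (θ : Fin M) (ω : Q.Ω), 0 < Q.weight ω →
    LinearIndependent F (fun (x : {x : Σ i : Fin N, LiftIndex N r M c i // θ ∈ x.2.1.2.2})
      (W : Messages F K M ℓ) =>
        response G W x.1.1 (restrictTo {θ} (Q.query θ ω x.1.1 x.1.2)))
  /-- in each round, decoding group `(k, g)` and set `S` of `k` undesired messages, the noise terms
  `b_0, …, b_{N-1}` of the `N` servers (whole `k`-queries for `S`, or the `S`-part of
  `(k+1)`-queries for `S ∪ {θ}`) are among the values that the noise queries of `O` can take,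
  so that they inherit the decoding equations of `O` -/
  noise : ∀ (θ : Fin M) (ω : Q.Ω), 0 < Q.weight ω →
    ∀ (ρ : Fin c), ∀ g ∈ groups N r M, ∀ S : Finset (Fin M), θ ∉ S → S.card = g.1 →
    ∀ x : (i : Fin N) → LiftIndex N r M c i,
      (∀ i, (x i).1.1 = ρ ∧ ((x i).1.2.1 : ℕ) = g.2 i ∧ (x i).1.2.2.erase θ = S) →
      ∃ ω' : O.Ω, 0 < O.weight ω' ∧ ∀ i, restrictTo S (Q.query θ ω i (x i)) = O.q ω' i

end PIR

/-! Put `n = N - r`, so that `K * n + T = N`. The responses to noise from a code `D` lie in the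
coordinatewise product of the storage code with `D`. For a generic `n × N` matrix `h`, the products
of a row of `G` with a row of `h` form a `K n × N` matrix all of whose maximal minors are nonzero.
Take as noise code `T` independent vectors `v` of its kernel. Any `T` coordinates of this code are
independent, and `h` annihilates every vector of noise responses. Since the `n`-minors of `h` are
nonzero too, the responses at any `r` servers determine the remaining `n`. Large fields serve only
this choice (`exists_noise_code`).

Fix the desired message `θ` and another message `m`. Each query that involves `m` plays exactly one
role in one decoding group: noise if its set omits `θ`, mixed otherwise. Each group meets every
server once. So all servers receive equally many queries involving `m`, namely `q = N ^ (M - 2)` per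
round, and these are arranged into `q` noise words, one for each pair of a group and a set
(`exists_label`). The number of queries, and so the rate, follows from the binomial theorem, because
`k + 1` occurs `(N - r) ^ k * r ^ (M - 1 - k)` times in the symbolic matrix.

The randomness is one uniform invertible matrix of size `N K q` for each message. It is applied to
coefficient rows that depend on `θ`: unit vectors for the desired message, zero-padded words of `v`
for the others. At any `T` servers the rows are independent in both cases, so an invertible matrix
carries one family to the other, and translation by it preserves the uniform measure. This gives
privacy for all rounds jointly (`liftedScheme_private`).

Correctness must hold for every value of the randomness. The transformed rows are therefore combined
with fixed vectors `U`, chosen so that for every invertible matrix over `F` the tensors of the code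
columns with the desired vectors are independent (`exists_generic_vectors`). Each of these finitely
many conditions is the nonvanishing of a nonzero polynomial, so they have a common solution over a
finite extension of `F`, of degree `d` say. Restriction of scalars gives `d` systems of vectors over
`F`, of length `ℓ = d N q`. There are `K d N q = K ℓ` tensors, hence they form a basis. Once the
noise is removed (`response_desired_eq_zero`), every linear functional of the desired message is
known. -/

namespace PIR

/-! ### Entropy of deterministic functions and of independent variables. -/

section Probability

variable {Ω α β : Type*} [Fintype Ω]

theorem sum_law [Fintype α] (p : Ω → ℝ) (X : Ω → α) : ∑ x, law p X x = ∑ ω, p ω := by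
  classical
  unfold law
  rw [Finset.sum_comm]
  simp

theorem law_comp_equiv {Ω' : Type*} [Fintype Ω'] (e : Ω' ≃ Ω) (p : Ω → ℝ) (X : Ω → α) (x : α) :
    law (p ∘ e) (X ∘ e) x = law p X x := by
  classical
  unfold law
  exact Equiv.sum_comp e fun ω => if X ω = x then p ω else 0

theorem law_of_bijective (w : ℝ) {X : Ω → α} (hX : Function.Bijective X) (x : α) :
    law (fun _ => w) X x = w := by
  classical
  obtain ⟨ω, rfl⟩ := hX.2 x
  unfold law
  simp [hX.1.eq_iff]

/-- `X` factors as `φ ∘ Y`, so the joint law lives on the graph of `φ` and has the same nonzero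
values as the law of `Y`. -/
theorem condEntropy_eq_zero [Fintype α] [Fintype β] (p : Ω → ℝ) (X : Ω → α) (Y : Ω → β)
    (h : ∀ ω ω', Y ω = Y ω' → X ω = X ω') : condEntropy p X Y = 0 := by
  classical
  rcases isEmpty_or_nonempty Ω with hΩ | ⟨⟨ω₀⟩⟩
  · simp [condEntropy, entropy, law]
  have : Nonempty α := ⟨X ω₀⟩
  obtain ⟨φ, hφ⟩ := (Function.factorsThrough_iff X).1 fun ω ω' => h ω ω'
  have key : ∀ y x, law p (fun ω => (X ω, Y ω)) (x, y) = if x = φ y then law p Y y else 0 := by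
    intro y x
    unfold law
    split_ifs with hx
    · refine Finset.sum_congr rfl fun ω _ => ?_
      by_cases hy : Y ω = y
      · simp [hφ, hx, hy]
      · simp [hy]
    · refine Finset.sum_eq_zero fun ω _ => if_neg fun hω => hx ?_
      obtain ⟨h1, h2⟩ := Prod.mk.inj hω
      rw [← h1, ← h2, hφ]; rfl
  unfold condEntropy entropy
  rw [Fintype.sum_prod_type_right, sub_eq_zero]
  refine Finset.sum_congr rfl fun y _ => ?_
  rw [Finset.sum_eq_single (φ y)]
  · rw [key, if_pos rfl]
  · intro x _ hx
    rw [key, if_neg hx, Real.negMulLog_zero]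
  · simp

/-- The joint law is the product of `μ` with the uniform law of the index, and entropy is additive
on products. -/
theorem mutualInfo_index_eq_zero [Fintype α] {M : ℕ} (hM : M ≠ 0) (w : Ω → ℝ)
    (hw : ∑ ω, w ω = 1) (X : Fin M × Ω → α) (μ : α → ℝ)
    (hμ : ∀ θ x, law w (fun ω => X (θ, ω)) x = μ x) :
    mutualInfo (fun s : Fin M × Ω => (M : ℝ)⁻¹ * w s.2) X (fun s => s.1) = 0 := by
  classical
  have hM' : (M : ℝ) ≠ 0 := by exact_mod_cast hM
  have h1 : ∀ x, law (fun s : Fin M × Ω => (M : ℝ)⁻¹ * w s.2) X x = μ x := by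
    intro x
    unfold law
    rw [Fintype.sum_prod_type]
    have : ∀ θ : Fin M, ∑ ω, (if X (θ, ω) = x then (M : ℝ)⁻¹ * w ω else 0) = (M : ℝ)⁻¹ * μ x := by
      intro θ
      rw [← hμ θ x, law, Finset.mul_sum]
      simp
    simp [this, hM']
  have h2 : ∀ θ, law (fun s : Fin M × Ω => (M : ℝ)⁻¹ * w s.2) (fun s => s.1) θ = (M : ℝ)⁻¹ := by
    intro θ
    unfold law
    rw [Fintype.sum_prod_type, Finset.sum_eq_single θ]
    · simp [← Finset.mul_sum, hw]
    · intro θ' _ h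
      simp [h]
    · simp
  have h3 : ∀ x θ, law (fun s : Fin M × Ω => (M : ℝ)⁻¹ * w s.2) (fun s => (X s, s.1)) (x, θ) =
      (M : ℝ)⁻¹ * μ x := by
    intro x θ
    unfold law
    rw [Fintype.sum_prod_type, Finset.sum_eq_single θ]
    · rw [← hμ θ x, law, Finset.mul_sum]
      simp
    · intro θ' _ h
      simp [h]
    · simp
  have h4 : ∑ x, μ x = 1 := by
    have := sum_law w (fun ω => X (⟨0, Nat.pos_of_ne_zero hM⟩, ω))
    simpa [hμ, hw] using this
  unfold mutualInfo entropy
  rw [Fintype.sum_prod_type]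
  simp only [h1, h2, h3, Real.negMulLog_mul, Finset.sum_add_distrib, Finset.sum_const,
    Finset.card_univ, Fintype.card_fin, nsmul_eq_mul, ← Finset.mul_sum, ← Finset.sum_mul, h4]
  field_simp
  ring

end Probability

end PIR
namespace PIR

/-! ### Cyclic shifts of the columns. -/

section Cyclic

variable {N : ℕ}

theorem cyc_stepsLeft (i j : Fin N) : cyc i (stepsLeft i j) = j := by
  have hi := i.2
  have hj := j.2
  apply Fin.ext
  simp only [cyc, stepsLeft, Nat.add_mod_mod]
  rw [show (i : ℕ) + (j + (N - i)) = j + N by omega, Nat.add_mod_right, Nat.mod_eq_of_lt hj]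

theorem stepsLeft_cyc (i : Fin N) {t : ℕ} (ht : t < N) : stepsLeft i (cyc i t) = t := by
  have hi := i.2
  simp only [cyc, stepsLeft, Nat.mod_add_mod]
  rw [show (i : ℕ) + t + (N - i) = t + N by omega, Nat.add_mod_right, Nat.mod_eq_of_lt ht]

theorem stepsLeft_lt (i j : Fin N) : stepsLeft i j < N := Nat.mod_lt _ i.pos

theorem cyc_injective (t : ℕ) : Function.Injective fun i : Fin N => cyc i t := by
  intro i j h
  have h' : (i : ℕ) + t ≡ j + t [MOD N] := congrArg Fin.val h
  have := Nat.ModEq.add_right_cancel' t h'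
  rw [Nat.ModEq, Nat.mod_eq_of_lt i.2, Nat.mod_eq_of_lt j.2] at this
  exact Fin.ext this

theorem cyc_bijective (t : ℕ) : Function.Bijective fun i : Fin N => cyc i t :=
  Finite.injective_iff_bijective.1 (cyc_injective t)

theorem stepsLeft_right_injective (i : Fin N) : Function.Injective fun j : Fin N => stepsLeft i j := by
  intro j j' h
  rw [← cyc_stepsLeft i j, ← cyc_stepsLeft i j']
  exact congrArg _ h

theorem stepsLeft_left_injective (j : Fin N) : Function.Injective fun i : Fin N => stepsLeft i j := by
  intro i i' h
  apply cyc_injective (stepsLeft i j)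
  change cyc i (stepsLeft i j) = cyc i' (stepsLeft i j)
  rw [cyc_stepsLeft, show stepsLeft i j = stepsLeft i' j from h, cyc_stepsLeft]

theorem sum_ite_val_lt {r : ℕ} (hr : r ≤ N) (a b : ℕ) :
    ∑ i : Fin N, (if (i : ℕ) < r then a else b) = r * a + (N - r) * b := by
  rw [Fin.sum_univ_eq_sum_range (fun i => if i < r then a else b) N,
    ← Finset.sum_range_add_sum_Ico _ hr]
  congr 1
  · rw [Finset.sum_congr rfl fun i hi => if_pos (Finset.mem_range.1 hi)]
    simp
  · rw [Finset.sum_congr rfl fun i hi => if_neg (not_lt.2 (Finset.mem_Ico.1 hi).1)]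
    simp

theorem sum_stepsLeft_lt {r : ℕ} (hr : r ≤ N) (j : Fin N) (a b : ℕ) :
    ∑ i : Fin N, (if stepsLeft i j < r then a else b) = r * a + (N - r) * b := by
  rw [← sum_ite_val_lt hr]
  refine Fintype.sum_bijective (fun i => (⟨stepsLeft i j, stepsLeft_lt i j⟩ : Fin N))
    (Finite.injective_iff_bijective.1 fun i i' h => stepsLeft_left_injective j ?_) _ _ fun i => rfl
  exact congrArg Fin.val h

end Cyclic

/-! ### Rows and entries of a lifted matrix. -/

section Blocks

variable {α : Type*}

theorem length_flatMap_range (f : ℕ → List α) {b : ℕ} (hf : ∀ t, (f t).length = b) (r : ℕ) :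
    ((List.range r).flatMap f).length = r * b := by
  simp [List.length_flatMap, hf]

theorem getD_flatMap_range (f : ℕ → List α) {b : ℕ} (hf : ∀ t, (f t).length = b) (d : α) (r : ℕ)
    {t x : ℕ} (ht : t < r) (hx : x < b) :
    ((List.range r).flatMap f).getD (t * b + x) d = (f t).getD x d := by
  induction r with
  | zero => omega
  | succ r ih =>
    rw [List.range_succ, List.flatMap_append]
    rcases Nat.lt_succ_iff_lt_or_eq.1 ht with h | rfl
    · rw [List.getD_append _ _ _ _ ?_, ih h]
      rw [length_flatMap_range f hf]
      nlinarith
    · rw [List.getD_append_right _ _ _ _ (by rw [length_flatMap_range f hf]; omega),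
        length_flatMap_range f hf, Nat.add_sub_cancel_left]
      simp

end Blocks

section Lift

variable {N : ℕ} {S : SymMatrix N} {m r : ℕ}

theorem mem_entriesOf {k : ℕ} {b : ℕ × Fin N} :
    b ∈ entriesOf k S ↔ b.1 < S.length ∧ S.getD b.1 0 b.2 = k := by
  obtain ⟨x, i⟩ := b
  simp [entriesOf, List.pair_mem_product]

theorem nodup_entriesOf (k : ℕ) : (entriesOf k S).Nodup :=
  ((List.nodup_range).product (List.nodup_finRange N)).filter _

theorem length_shiftLeft (t : ℕ) : (shiftLeft t S).length = S.length := by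
  simp [shiftLeft]

theorem getD_shiftLeft (t x : ℕ) (i : Fin N) :
    (shiftLeft t S).getD x 0 i = S.getD x 0 (cyc i t) := by
  by_cases hx : x < S.length
  · rw [List.getD_eq_getElem _ _ (by rwa [length_shiftLeft]), List.getD_eq_getElem _ _ hx]
    unfold shiftLeft
    rw [List.getElem_map]
  · rw [List.getD_eq_default _ _ (by rw [length_shiftLeft]; omega),
      List.getD_eq_default _ _ (by omega)]
    rfl

theorem length_lift : (lift m r S).length = r * S.length + (entriesOf m S).length := by
  rw [lift, List.length_append, length_flatMap_range _ length_shiftLeft, List.length_map]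

theorem getD_lift_copy {t x : ℕ} (ht : t < r) (hx : x < S.length) (i : Fin N) :
    (lift m r S).getD (t * S.length + x) 0 i = S.getD x 0 (cyc i t) := by
  rw [lift, List.getD_append _ _ _ _ ?_, getD_flatMap_range _ length_shiftLeft _ _ ht hx,
    getD_shiftLeft]
  rw [length_flatMap_range _ length_shiftLeft]
  nlinarith

theorem getD_lift_new {x : ℕ} (hx : x < (entriesOf m S).length) (i : Fin N) :
    (lift m r S).getD (r * S.length + x) 0 i =
      if stepsLeft i ((entriesOf m S)[x]).2 < r then 0 else m + 1 := by
  rw [lift, List.getD_append_right _ _ _ _ (by rw [length_flatMap_range _ length_shiftLeft]; omega),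
    length_flatMap_range _ length_shiftLeft, Nat.add_sub_cancel_left,
    List.getD_eq_getElem _ _ (by simpa using hx)]
  simp

theorem lift_row_cases {x : ℕ} (hx : x < (lift m r S).length) :
    (∃ t y, t < r ∧ y < S.length ∧ x = t * S.length + y) ∨
      ∃ y, y < (entriesOf m S).length ∧ x = r * S.length + y := by
  rw [length_lift] at hx
  by_cases h : x < r * S.length
  · have hpos : 0 < S.length := by
      rcases Nat.eq_zero_or_pos S.length with h0 | h0
      · rw [h0] at h; omega
      · exact h0
    refine Or.inl ⟨x / S.length, x % S.length, (Nat.div_lt_iff_lt_mul hpos).2 h,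
      Nat.mod_lt _ hpos, ?_⟩
    rw [mul_comm, Nat.div_add_mod]
  · exact Or.inr ⟨x - r * S.length, by omega, by omega⟩

end Lift

/-! ### Decoding groups and their behaviour under lifting. -/

/-- The decoding groups `Γ` of the matrix `S` with entries at most `m`: each entry `v` with
`1 ≤ v < m` is a noise entry of exactly one group, and each entry `v ≥ 2` is a mixed entry of
exactly one group. -/
structure IsGrouping {N : ℕ} (r m : ℕ) (S : SymMatrix N) (Γ : List (ℕ × (Fin N → ℕ))) : Prop where
  row_lt : ∀ g ∈ Γ, ∀ i, g.2 i < S.length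
  lt : ∀ g ∈ Γ, g.1 < m
  value : ∀ g ∈ Γ, ∀ i, S.getD (g.2 i) 0 i = g.1 ∨ S.getD (g.2 i) 0 i = g.1 + 1
  sum_mixed : ∀ g ∈ Γ, ∑ i, (if S.getD (g.2 i) 0 i = g.1 + 1 then 1 else 0) = N - r
  unique : ∀ g ∈ Γ, ∀ g' ∈ Γ, g.1 = g'.1 → ∀ i, g.2 i = g'.2 i → g = g'
  exists_noise : ∀ i, ∀ x < S.length, 1 ≤ S.getD x 0 i → S.getD x 0 i < m →
    ∃ g ∈ Γ, g.2 i = x ∧ S.getD x 0 i = g.1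
  exists_mixed : ∀ i, ∀ x < S.length, 2 ≤ S.getD x 0 i →
    ∃ g ∈ Γ, g.2 i = x ∧ S.getD x 0 i = g.1 + 1

/-- The decoding groups after lifting. -/
def liftGroups {N : ℕ} (m r : ℕ) (S : SymMatrix N) (Γ : List (ℕ × (Fin N → ℕ))) :
    List (ℕ × (Fin N → ℕ)) :=
  (List.range r).flatMap (fun t => Γ.map
      fun g => (g.1, fun i => t * S.length + g.2 (cyc i t))) ++
    (entriesOf m S).zipIdx.map fun bn => (m, fun i =>
      if stepsLeft i bn.1.2 < r then bn.1.1 + stepsLeft i bn.1.2 * S.length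
      else r * S.length + bn.2)

theorem mem_liftGroups {N m r : ℕ} {S : SymMatrix N} {Γ : List (ℕ × (Fin N → ℕ))}
    {g : ℕ × (Fin N → ℕ)} : g ∈ liftGroups m r S Γ ↔
      (∃ t < r, ∃ g' ∈ Γ, g = (g'.1, fun i => t * S.length + g'.2 (cyc i t))) ∨
      ∃ y, ∃ hy : y < (entriesOf m S).length, g = (m, fun i =>
        if stepsLeft i ((entriesOf m S)[y]).2 < r
        then ((entriesOf m S)[y]).1 + stepsLeft i ((entriesOf m S)[y]).2 * S.length
        else r * S.length + y) := by
  rw [liftGroups, List.mem_append]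
  refine or_congr ?_ ?_
  · simp only [List.mem_flatMap, List.mem_range, List.mem_map]
    constructor
    · rintro ⟨t, ht, g', hg', rfl⟩
      exact ⟨t, ht, g', hg', rfl⟩
    · rintro ⟨t, ht, g', hg', rfl⟩
      exact ⟨t, ht, g', hg', rfl⟩
  · simp only [List.mem_map]
    constructor
    · rintro ⟨⟨b, y⟩, hb, rfl⟩
      rw [List.mem_zipIdx_iff_getElem?, List.getElem?_eq_some_iff] at hb
      obtain ⟨hy, hb⟩ := hb
      dsimp only at hy hb
      subst hb
      exact ⟨y, hy, rfl⟩
    · rintro ⟨y, hy, rfl⟩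
      refine ⟨((entriesOf m S)[y], y), ?_, rfl⟩
      rw [List.mem_zipIdx_iff_getElem?]
      exact List.getElem?_eq_getElem hy

theorem block_eq {b t t' x x' : ℕ} (hx : x < b) (hx' : x' < b) (h : t * b + x = t' * b + x') :
    t = t' ∧ x = x' := by
  have h1 : t = t' := by
    rcases lt_trichotomy t t' with h1 | h1 | h1
    · nlinarith
    · exact h1
    · nlinarith
  subst h1
  exact ⟨rfl, by omega⟩

/-- Entries below `m` keep their shifted groups in each copy. Entries `m` had no noise role before:
their copies are exactly the noise entries of the new groups. The entries `m + 1` of the new rows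
are mixed entries there, and have no noise role yet. -/
theorem IsGrouping.lift {N r m : ℕ} (hr : r ≤ N) {S : SymMatrix N} {Γ : List (ℕ × (Fin N → ℕ))}
    (h : IsGrouping r m S Γ) :
    IsGrouping r (m + 1) (lift m r S) (liftGroups m r S Γ) := by
  have hent : ∀ y (hy : y < (entriesOf m S).length),
      ((entriesOf m S)[y]).1 < S.length ∧
        S.getD ((entriesOf m S)[y]).1 0 ((entriesOf m S)[y]).2 = m :=
    fun y hy => mem_entriesOf.1 (List.getElem_mem hy)
  have hcopy_lt : ∀ {t x}, t < r → x < S.length → t * S.length + x < r * S.length := by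
    intro t x ht hx
    nlinarith
  -- values of the new groups
  have hnew : ∀ y (hy : y < (entriesOf m S).length) (i : Fin N),
      (PIR.lift m r S).getD (if stepsLeft i ((entriesOf m S)[y]).2 < r
        then ((entriesOf m S)[y]).1 + stepsLeft i ((entriesOf m S)[y]).2 * S.length
        else r * S.length + y) 0 i =
      if stepsLeft i ((entriesOf m S)[y]).2 < r then m else m + 1 := by
    intro y hy i
    split_ifs with hs
    · rw [add_comm, getD_lift_copy hs (hent y hy).1, cyc_stepsLeft, (hent y hy).2]
    · rw [getD_lift_new hy, if_neg hs]
  refine ⟨?_, ?_, ?_, ?_, ?_, ?_, ?_⟩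
  · intro g hg i
    rw [length_lift]
    rcases mem_liftGroups.1 hg with ⟨t, ht, g', hg', rfl⟩ | ⟨y, hy, rfl⟩
    · have := hcopy_lt ht (h.row_lt g' hg' (cyc i t))
      dsimp only
      omega
    · dsimp only
      split_ifs with hs
      · have := hcopy_lt hs (hent y hy).1
        omega
      · omega
  · intro g hg
    rcases mem_liftGroups.1 hg with ⟨t, ht, g', hg', rfl⟩ | ⟨y, hy, rfl⟩
    · exact (h.lt g' hg').trans (Nat.lt_succ_self m)
    · exact Nat.lt_succ_self m
  · intro g hg i
    rcases mem_liftGroups.1 hg with ⟨t, ht, g', hg', rfl⟩ | ⟨y, hy, rfl⟩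
    · dsimp only
      rw [getD_lift_copy ht (h.row_lt g' hg' _)]
      exact h.value g' hg' _
    · dsimp only
      rw [hnew y hy i]
      split_ifs
      · exact Or.inl rfl
      · exact Or.inr rfl
  · intro g hg
    rcases mem_liftGroups.1 hg with ⟨t, ht, g', hg', rfl⟩ | ⟨y, hy, rfl⟩
    · dsimp only
      simp only [getD_lift_copy ht (h.row_lt g' hg' _)]
      rw [← h.sum_mixed g' hg']
      exact (cyc_bijective t).sum_comp
        fun i => if S.getD (g'.2 i) 0 i = g'.1 + 1 then 1 else 0
    · dsimp only
      simp only [hnew y hy]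
      refine Eq.trans ?_ ((sum_stepsLeft_lt hr ((entriesOf m S)[y]).2 0 1).trans (by simp))
      refine Finset.sum_congr rfl fun i _ => ?_
      by_cases hs : stepsLeft i ((entriesOf m S)[y]).2 < r <;> simp only [hs] <;> simp
  · intro g hg g' hg' hk i hi
    rcases mem_liftGroups.1 hg with ⟨t, ht, g, hg₀, rfl⟩ | ⟨y, hy, rfl⟩ <;>
      rcases mem_liftGroups.1 hg' with ⟨t', ht', g', hg₀', rfl⟩ | ⟨y', hy', rfl⟩
    · dsimp only at hk hi
      obtain ⟨rfl, h2⟩ := block_eq (h.row_lt g hg₀ _) (h.row_lt g' hg₀' _) hi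
      rw [h.unique g hg₀ g' hg₀' hk _ h2]
    · exact absurd hk (h.lt g hg₀).ne
    · exact absurd hk (h.lt g' hg₀').ne'
    · dsimp only at hi
      -- In column `i` a new group meets either its own new row or a copy of its entry. The index of
      -- the copy reveals the column of that entry and the position inside the copy its row.
      have heq : y = y' := by
        split_ifs at hi with h1 h2 h2
        · rw [add_comm, add_comm ((entriesOf m S)[y']).1] at hi
          obtain ⟨h3, h4⟩ := block_eq (hent y hy).1 (hent y' hy').1 hi
          have h5 := stepsLeft_right_injective i h3
          exact (nodup_entriesOf m).getElem_inj_iff.1 (Prod.ext h4 h5)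
        · have := hcopy_lt h1 (hent y hy).1
          omega
        · have := hcopy_lt h2 (hent y' hy').1
          omega
        · omega
      subst heq
      rfl
  · intro i x hx h1 h2
    rcases lift_row_cases hx with ⟨t, y, ht, hy, rfl⟩ | ⟨y, hy, rfl⟩
    · rw [getD_lift_copy ht hy] at h1 h2 ⊢
      rcases Nat.lt_succ_iff_lt_or_eq.1 h2 with h3 | h3
      · obtain ⟨g, hg, rfl, hv⟩ := h.exists_noise _ y hy h1 h3
        exact ⟨_, mem_liftGroups.2 (Or.inl ⟨t, ht, g, hg, rfl⟩), rfl, hv⟩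
      · have hmem : (y, cyc i t) ∈ entriesOf m S := mem_entriesOf.2 ⟨hy, h3⟩
        obtain ⟨z, hz, hzeq⟩ := List.mem_iff_getElem.1 hmem
        refine ⟨_, mem_liftGroups.2 (Or.inr ⟨z, hz, rfl⟩), ?_, h3⟩
        dsimp only
        rw [hzeq]
        dsimp only
        rw [stepsLeft_cyc i (ht.trans_le hr), if_pos ht, add_comm]
    -- A new row contains only `0` and `m + 1`, so none of its entries lies between `1` and `m`.
    · rw [getD_lift_new hy] at h1 h2
      split_ifs at h1 h2 <;> omega
  · intro i x hx h2
    rcases lift_row_cases hx with ⟨t, y, ht, hy, rfl⟩ | ⟨y, hy, rfl⟩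
    · rw [getD_lift_copy ht hy] at h2 ⊢
      obtain ⟨g, hg, rfl, hv⟩ := h.exists_mixed _ y hy h2
      exact ⟨_, mem_liftGroups.2 (Or.inl ⟨t, ht, g, hg, rfl⟩), rfl, hv⟩
    · rw [getD_lift_new hy] at h2 ⊢
      split_ifs at h2 ⊢ with hs
      · omega
      · refine ⟨_, mem_liftGroups.2 (Or.inr ⟨y, hy, rfl⟩), ?_, rfl⟩
        dsimp only
        rw [if_neg hs]

theorem isGrouping_symbolicMatrix {N r : ℕ} (hr : r ≤ N) (m : ℕ) :
    IsGrouping r (m + 2) (symbolicMatrix N r (m + 2)) (groups N r (m + 2)) := by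
  induction m with
  | zero =>
    have hval : ∀ i : Fin N, (symbolicMatrix N r 2).getD 0 0 i = if (i : ℕ) < r then 1 else 2 :=
      fun i => rfl
    refine ⟨?_, ?_, ?_, ?_, ?_, ?_, ?_⟩
    · intro g hg i
      simp only [groups, List.mem_singleton] at hg
      subst hg
      simp [symbolicMatrix]
    · intro g hg
      simp only [groups, List.mem_singleton] at hg
      subst hg
      exact one_lt_two
    · intro g hg i
      simp only [groups, List.mem_singleton] at hg
      subst hg
      change (if (i : ℕ) < r then 1 else 2) = 1 ∨ (if (i : ℕ) < r then 1 else 2) = 2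
      split_ifs <;> simp
    · intro g hg
      simp only [groups, List.mem_singleton] at hg
      subst hg
      change ∑ i : Fin N, (if (if (i : ℕ) < r then 1 else 2) = 2 then 1 else 0) = N - r
      refine Eq.trans ?_ ((sum_ite_val_lt hr 0 1).trans (by simp))
      refine Finset.sum_congr rfl fun i _ => ?_
      split_ifs <;> simp_all
    · intro g hg g' hg' _ _ _
      simp only [groups, List.mem_singleton] at hg hg'
      rw [hg, hg']
    · intro i x hx h1 h2
      simp only [symbolicMatrix, List.length_singleton, Nat.lt_one_iff] at hx
      subst hx
      exact ⟨_, List.mem_singleton.2 rfl, rfl, by omega⟩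
    · intro i x hx h2
      simp only [symbolicMatrix, List.length_singleton, Nat.lt_one_iff] at hx
      subst hx
      refine ⟨_, List.mem_singleton.2 rfl, rfl, ?_⟩
      rw [hval] at h2 ⊢
      split_ifs at h2 ⊢ <;> omega
  | succ m ih => exact ih.lift hr

/-! ### Counting the entries of the symbolic matrix. -/

section Counting

variable {N : ℕ}

/-- The sum of `φ` over all entries of a matrix. -/
def entrySum (φ : ℕ → ℕ) (S : SymMatrix N) : ℕ := (S.map fun row => ∑ i, φ (row i)).sum

theorem entrySum_append (φ : ℕ → ℕ) (S S' : SymMatrix N) :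
    entrySum φ (S ++ S') = entrySum φ S + entrySum φ S' := by
  simp [entrySum]

theorem entrySum_shiftLeft (φ : ℕ → ℕ) (t : ℕ) (S : SymMatrix N) :
    entrySum φ (shiftLeft t S) = entrySum φ S := by
  unfold entrySum shiftLeft
  rw [List.map_map]
  congr 1
  refine List.map_congr_left fun row _ => ?_
  exact (cyc_bijective t).sum_comp fun i => φ (row i)

theorem entrySum_eq_sum (φ : ℕ → ℕ) (S : SymMatrix N) :
    entrySum φ S = ∑ x : Fin S.length, ∑ i, φ (S.get x i) := by
  unfold entrySum
  rw [← Fin.sum_univ_fun_getElem]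
  rfl

theorem length_entriesOf (k : ℕ) (S : SymMatrix N) :
    (entriesOf k S).length = entrySum (fun v => if v = k then 1 else 0) S := by
  have h : entriesOf k S = ((List.range S.length).flatMap fun x =>
      ((List.finRange N).filter fun i => S.getD x 0 i = k).map (Prod.mk x)) := by
    rw [entriesOf]
    unfold List.product
    rw [List.filter_flatMap]
    simp only [List.filter_map]
    rfl
  rw [h, List.length_flatMap, entrySum_eq_sum, ← Fin.sum_univ_getElem]
  simp only [List.length_map]
  refine Fintype.sum_equiv (finCongr (by simp)) _ _ fun x => ?_
  simp only [List.getElem_map, List.getElem_range]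
  rw [← List.toFinset_card_of_nodup ((List.nodup_finRange N).filter _), Finset.sum_boole]
  simp only [Nat.cast_id]
  congr 1
  ext i
  have hx : (x : ℕ) < S.length := by simpa using x.2
  simp [List.getElem?_eq_getElem hx]

theorem entrySum_lift (φ : ℕ → ℕ) (hφ : φ 0 = 0) {r : ℕ} (hr : r ≤ N) (m : ℕ) (S : SymMatrix N) :
    entrySum φ (lift m r S) = r * entrySum φ S +
      (N - r) * φ (m + 1) * entrySum (fun v => if v = m then 1 else 0) S := by
  rw [lift, entrySum_append]
  congr 1
  · induction r with
    | zero => simp [entrySum]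
    | succ r ih =>
      rw [List.range_succ, List.flatMap_append, entrySum_append, ih (by omega)]
      simp [entrySum_shiftLeft]
      ring
  · rw [← length_entriesOf, entrySum, List.map_map]
    have : ∀ b ∈ entriesOf m S, ((fun row : Fin N → ℕ => ∑ i, φ (row i)) ∘
        fun (b : ℕ × Fin N) i => if stepsLeft i b.2 < r then 0 else m + 1) b =
        (N - r) * φ (m + 1) := by
      intro b _
      have h := sum_stepsLeft_lt hr b.2 0 (φ (m + 1))
      rw [mul_zero, zero_add] at h
      rw [← h]
      refine Finset.sum_congr rfl fun i _ => ?_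
      dsimp only
      split_ifs
      · exact hφ
      · rfl
    rw [List.map_congr_left this]
    simp [mul_comm]

/-- The weight `φ` is arbitrary so that the induction can also be applied to the indicator of the
largest entry, whose multiplicity is the number of new rows. -/
theorem entrySum_symbolicMatrix {r : ℕ} (hr : r ≤ N) (m : ℕ) (φ : ℕ → ℕ) (hφ : φ 0 = 0) :
    entrySum φ (symbolicMatrix N r (m + 2)) =
      ∑ k ∈ Finset.range (m + 2), (N - r) ^ k * r ^ (m + 1 - k) * φ (k + 1) := by
  induction m generalizing φ with
  | zero =>
    have : entrySum φ (symbolicMatrix N r 2) = ∑ i : Fin N, if (i : ℕ) < r then φ 1 else φ 2 := by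
      simp only [entrySum, symbolicMatrix, List.map_cons, List.map_nil, List.sum_cons,
        List.sum_nil, add_zero]
      refine Finset.sum_congr rfl fun i _ => ?_
      split_ifs <;> rfl
    rw [this, sum_ite_val_lt hr]
    simp [Finset.sum_range_succ]
  | succ m ih =>
    change entrySum φ (lift (m + 2) r (symbolicMatrix N r (m + 2))) = _
    rw [entrySum_lift φ hφ hr, ih φ hφ, ih _ (by simp),
      Finset.sum_range_succ _ (m + 2), Finset.mul_sum]
    congr 1
    · refine Finset.sum_congr rfl fun k hk => ?_
      rw [Finset.mem_range] at hk
      rw [show m + 1 + 1 - k = (m + 1 - k) + 1 by omega, pow_succ]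
      ring
    · rw [Finset.sum_eq_single (m + 1)]
      · simp
        ring
      · intro k _ hk
        rw [if_neg (by omega), mul_zero]
      · simp

end Counting

end PIR
namespace PIR

/-! ### Arranging the queries about an undesired message into noise words. -/

section Labels

variable {N r M : ℕ}

/-- The queries to server `i` in one round: the pairs (row, set of messages). -/
def IsRoundQuery (i : Fin N) (y : Fin (symbolicMatrix N r M).length × Finset (Fin M)) : Prop :=
  y.2.Nonempty ∧ y.2.card = (symbolicMatrix N r M).get y.1 i

/-- The queries to server `i` that involve message `m`, in one round. -/
abbrev MessageQuery (N r M : ℕ) (i : Fin N) (m : Fin M) : Type :=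
  {y : Fin (symbolicMatrix N r M).length × Finset (Fin M) // IsRoundQuery i y ∧ m ∈ y.2}

/-- The pairs of a decoding group `(k, g)` and a set of `k` messages that contains `m`, not `θ`. -/
abbrev NoiseTuple (N r M : ℕ) (θ m : Fin M) : Type :=
  {p : (ℕ × (Fin N → ℕ)) × Finset (Fin M) //
    p.1 ∈ groups N r M ∧ θ ∉ p.2 ∧ p.2.card = p.1.1 ∧ m ∈ p.2}

theorem card_sets_mem (m : Fin M) (k : ℕ) :
    (Finset.univ.filter fun S : Finset (Fin M) => m ∈ S ∧ S.card = k + 1).card =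
      (M - 1).choose k := by
  have h : ((Finset.univ.erase m).powersetCard k).card = (M - 1).choose k := by
    rw [Finset.card_powersetCard, Finset.card_erase_of_mem (Finset.mem_univ m), Finset.card_univ,
      Fintype.card_fin]
  rw [← h]
  refine Finset.card_nbij' (fun S => S.erase m) (fun S => insert m S) ?_ ?_ ?_ ?_
  · intro S hS
    simp only [Finset.coe_filter, Finset.mem_univ, true_and, Set.mem_ofPred_eq] at hS
    simp only [Finset.mem_coe, Finset.mem_powersetCard]
    refine ⟨Finset.erase_subset_erase m (Finset.subset_univ S), ?_⟩
    rw [Finset.card_erase_of_mem hS.1, hS.2, Nat.add_sub_cancel]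
  · intro S hS
    simp only [Finset.mem_coe, Finset.mem_powersetCard] at hS
    have hm : m ∉ S := fun hm => Finset.notMem_erase m _ (hS.1 hm)
    simp [Finset.card_insert_of_notMem hm, hS.2]
  · intro S hS
    simp only [Finset.coe_filter, Finset.mem_univ, true_and, Set.mem_ofPred_eq] at hS
    exact Finset.insert_erase hS.1
  · intro S hS
    simp only [Finset.mem_coe, Finset.mem_powersetCard] at hS
    exact Finset.erase_insert fun hm => Finset.notMem_erase m _ (hS.1 hm)

theorem symbolicMatrix_get_eq (i : Fin N) (x : Fin (symbolicMatrix N r M).length) :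
    (symbolicMatrix N r M).get x i = (symbolicMatrix N r M).getD x 0 i := by
  rw [List.getD_eq_getElem _ _ x.2]
  rfl

theorem sum_card_messageQuery (hr : r ≤ N) (hM : 2 ≤ M) (m : Fin M) :
    ∑ i, Nat.card (MessageQuery N r M i m) = N ^ (M - 1) := by
  classical
  set φ : ℕ → ℕ := fun v =>
    (Finset.univ.filter fun S : Finset (Fin M) => m ∈ S ∧ S.card = v).card with hφ
  have hφ0 : φ 0 = 0 := by
    rw [hφ]
    simp only [Finset.card_eq_zero, Finset.filter_eq_empty_iff, Finset.mem_univ, true_implies]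
    rintro S ⟨h1, h2⟩
    rw [h2] at h1
    exact Finset.notMem_empty m h1
  have h1 : ∑ i, Nat.card (MessageQuery N r M i m) = entrySum φ (symbolicMatrix N r M) := by
    rw [entrySum_eq_sum, Finset.sum_comm]
    refine Finset.sum_congr rfl fun i _ => ?_
    rw [Nat.card_eq_fintype_card, Fintype.card_subtype, ← Finset.univ_product_univ,
      Finset.card_filter, Finset.sum_product]
    refine Finset.sum_congr rfl fun x _ => ?_
    rw [hφ]
    dsimp only
    rw [Finset.card_filter]
    refine Finset.sum_congr rfl fun S _ => if_congr ?_ rfl rfl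
    constructor
    · rintro ⟨⟨_, h⟩, hm⟩
      exact ⟨hm, h⟩
    · rintro ⟨hm, h⟩
      exact ⟨⟨⟨m, hm⟩, h⟩, hm⟩
  obtain ⟨M, rfl⟩ := Nat.exists_eq_add_of_le' hM
  rw [h1, entrySum_symbolicMatrix hr M φ hφ0, show M + 2 - 1 = M + 1 by omega]
  -- Binomial expansion of `((N - r) + r) ^ (M + 1)`: an entry `k + 1` contributes `(M + 1).choose
  -- k` sets that contain `m`.
  conv_rhs => rw [← Nat.sub_add_cancel hr, add_pow]
  refine Finset.sum_congr rfl fun k _ => ?_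
  rw [hφ]
  dsimp only
  rw [card_sets_mem]
  rfl

theorem sum_card_roundQuery (hr : r ≤ N) (hM : 2 ≤ M) :
    (N - r) * ∑ i, Nat.card {y : Fin (symbolicMatrix N r M).length × Finset (Fin M) //
      IsRoundQuery i y} + r ^ M = N ^ M := by
  classical
  -- Entries `0` stand for no query, although there is one empty set. The missing term is the `r ^
  -- M` of the statement.
  set φ : ℕ → ℕ := fun v => if v = 0 then 0 else M.choose v with hφ
  have h1 : ∑ i, Nat.card {y : Fin (symbolicMatrix N r M).length × Finset (Fin M) //
      IsRoundQuery i y} = entrySum φ (symbolicMatrix N r M) := by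
    rw [entrySum_eq_sum, Finset.sum_comm]
    refine Finset.sum_congr rfl fun i _ => ?_
    rw [Nat.card_eq_fintype_card, Fintype.card_subtype, ← Finset.univ_product_univ,
      Finset.card_filter, Finset.sum_product]
    refine Finset.sum_congr rfl fun x _ => ?_
    rw [hφ]
    dsimp only
    rw [← Finset.card_filter]
    split_ifs with h0
    · rw [Finset.card_eq_zero, Finset.filter_eq_empty_iff]
      rintro S - ⟨h2, h3⟩
      exact h2.card_pos.ne' (h3.trans h0)
    · have : (M.choose ((symbolicMatrix N r M).get x i)) =
          ((Finset.univ : Finset (Fin M)).powersetCard ((symbolicMatrix N r M).get x i)).card := by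
        rw [Finset.card_powersetCard, Finset.card_univ, Fintype.card_fin]
      rw [this]
      congr 1
      ext S
      simp only [Finset.mem_filter, Finset.mem_univ, true_and, Finset.mem_powersetCard,
        Finset.subset_univ]
      exact ⟨fun h => h.2, fun h => ⟨Finset.card_pos.1 (by dsimp only; omega), h⟩⟩
  obtain ⟨M, rfl⟩ := Nat.exists_eq_add_of_le' hM
  rw [h1, entrySum_symbolicMatrix hr M φ rfl]
  conv_rhs => rw [← Nat.sub_add_cancel hr, add_pow, Finset.sum_range_succ']
  rw [Finset.mul_sum]
  congr 1
  · refine Finset.sum_congr rfl fun k _ => ?_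
    rw [hφ]
    dsimp only
    rw [if_neg (Nat.succ_ne_zero k), show M + 2 - (k + 1) = M + 1 - k by omega, pow_succ]
    simp only [Nat.cast_id]
    ring
  · simp

/-- The query to server `i` that belongs to a decoding group and a set of undesired messages. -/
def NoiseTuple.query (hr : r ≤ N) (hM : 2 ≤ M) {θ m : Fin M} (i : Fin N)
    (p : NoiseTuple N r M θ m) : MessageQuery N r M i m :=
  ⟨(⟨p.1.1.2 i, by
      obtain ⟨M, rfl⟩ := Nat.exists_eq_add_of_le' hM
      exact (isGrouping_symbolicMatrix hr M).row_lt _ p.2.1 i⟩,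
    if (symbolicMatrix N r M).getD (p.1.1.2 i) 0 i = p.1.1.1 then p.1.2 else insert θ p.1.2), by
    obtain ⟨M, rfl⟩ := Nat.exists_eq_add_of_le' hM
    obtain ⟨⟨g, S⟩, hg, hθ, hS, hm⟩ := p
    have hmem : m ∈ if (symbolicMatrix N r (M + 2)).getD (g.2 i) 0 i = g.1 then S
        else insert θ S := by
      split_ifs
      · exact hm
      · exact Finset.mem_insert_of_mem hm
    refine ⟨⟨⟨m, hmem⟩, ?_⟩, hmem⟩
    dsimp only at hS ⊢
    rw [symbolicMatrix_get_eq]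
    rcases (isGrouping_symbolicMatrix hr M).value g hg i with h | h
    · rw [if_pos h]
      exact hS.trans h.symm
    · rw [if_neg (by omega), Finset.card_insert_of_notMem hθ]
      exact (congrArg Nat.succ hS).trans h.symm⟩

theorem NoiseTuple.query_erase (hr : r ≤ N) (hM : 2 ≤ M) {θ m : Fin M} (i : Fin N)
    (p : NoiseTuple N r M θ m) : (p.query hr hM i).1.2.erase θ = p.1.2 := by
  change Finset.erase (if (symbolicMatrix N r M).getD (p.1.1.2 i) 0 i = p.1.1.1 then p.1.2
    else insert θ p.1.2) θ = p.1.2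
  split_ifs
  · exact Finset.erase_eq_of_notMem p.2.2.1
  · exact Finset.erase_insert p.2.2.1

/-- Erasing `θ` recovers the set, its size the value `k`; then `k` and the row single out the group.
-/
theorem NoiseTuple.query_injective (hr : r ≤ N) (hM : 2 ≤ M) {θ m : Fin M} (i : Fin N) :
    Function.Injective (NoiseTuple.query (θ := θ) (m := m) hr hM i) := by
  intro p p' h
  have hS : p.1.2 = p'.1.2 := by
    rw [← p.query_erase hr hM i, ← p'.query_erase hr hM i, h]
  have hrow : p.1.1.2 i = p'.1.1.2 i := congrArg (fun y => (y.1.1 : ℕ)) h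
  have hk : p.1.1.1 = p'.1.1.1 := by rw [← p.2.2.2.1, ← p'.2.2.2.1, hS]
  obtain ⟨M, rfl⟩ := Nat.exists_eq_add_of_le' hM
  exact Subtype.ext (Prod.ext
    ((isGrouping_symbolicMatrix hr M).unique _ p.2.1 _ p'.2.1 hk i hrow) hS)

/-- A query to server `i` lies in exactly one decoding group in the role that its set of messages
prescribes. -/
theorem exists_group (hr : r ≤ N) (hM : 2 ≤ M) {θ m : Fin M} (hm : m ≠ θ) (i : Fin N)
    (y : MessageQuery N r M i m) :
    ∃ g ∈ groups N r M, g.2 i = y.1.1 ∧ (y.1.2.erase θ).card = g.1 := by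
  obtain ⟨⟨x, S⟩, ⟨hne, hcard⟩, hmS⟩ := y
  dsimp only at hne hcard hmS ⊢
  rw [symbolicMatrix_get_eq] at hcard
  obtain ⟨M, rfl⟩ := Nat.exists_eq_add_of_le' hM
  have hpos := hne.card_pos
  by_cases hθ : θ ∈ S
  -- The set contains both `m` and `θ`, so the entry is at least `2` and has a mixed role.
  · have h2 : 1 < S.card := Finset.one_lt_card.2 ⟨m, hmS, θ, hθ, hm⟩
    obtain ⟨g, hg, hx, hv⟩ :=
      (isGrouping_symbolicMatrix hr M).exists_mixed i x x.2 (by omega)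
    refine ⟨g, hg, hx, ?_⟩
    rw [Finset.card_erase_of_mem hθ]
    omega
  -- The set omits `θ`, so the entry is not the largest possible and has a noise role.
  · have h2 : S.card < M + 2 := by
      have h3 : S ⊂ Finset.univ := Finset.ssubset_univ_iff.2 fun h => hθ (h ▸ Finset.mem_univ θ)
      simpa using Finset.card_lt_card h3
    obtain ⟨g, hg, hx, hv⟩ :=
      (isGrouping_symbolicMatrix hr M).exists_noise i x x.2 (by omega) (by omega)
    refine ⟨g, hg, hx, ?_⟩
    rw [Finset.erase_eq_of_notMem hθ]
    omega

theorem NoiseTuple.query_eq (hr : r ≤ N) (hM : 2 ≤ M) {θ m : Fin M} (i : Fin N)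
    (p : NoiseTuple N r M θ m) (y : MessageQuery N r M i m) (hrow : (y.1.1 : ℕ) = p.1.1.2 i)
    (hS : y.1.2.erase θ = p.1.2) : p.query hr hM i = y := by
  obtain ⟨⟨x, S⟩, ⟨hne, hcard⟩, hmS⟩ := y
  obtain ⟨⟨g, S'⟩, hg, hθ', hS', hm'⟩ := p
  dsimp only at hne hcard hmS hrow hS hS'
  subst hS
  rw [symbolicMatrix_get_eq, hrow] at hcard
  refine Subtype.ext (Prod.ext (Fin.ext hrow.symm) ?_)
  change (if (symbolicMatrix N r M).getD (g.2 i) 0 i = g.1 then S.erase θ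
    else insert θ (S.erase θ)) = S
  by_cases hθ : θ ∈ S
  · have hpos := hne.card_pos
    rw [Finset.card_erase_of_mem hθ] at hS'
    rw [if_neg (by omega), Finset.insert_erase hθ]
  · rw [Finset.erase_eq_of_notMem hθ] at hS' ⊢
    rw [if_pos (by omega)]

theorem NoiseTuple.query_surjective (hr : r ≤ N) (hM : 2 ≤ M) {θ m : Fin M} (hm : m ≠ θ)
    (i : Fin N) : Function.Surjective (NoiseTuple.query (θ := θ) (m := m) hr hM i) := by
  intro y
  obtain ⟨g, hg, hx, hk⟩ := exists_group hr hM hm i y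
  exact ⟨⟨(g, y.1.2.erase θ), hg, Finset.notMem_erase θ _, hk, Finset.mem_erase.2 ⟨hm, y.2.2⟩⟩,
    NoiseTuple.query_eq hr hM i _ y hx.symm rfl⟩

theorem card_noiseTuple (hr : r ≤ N) (hM : 2 ≤ M) {θ m : Fin M} (hm : m ≠ θ) (i : Fin N) :
    Nat.card (NoiseTuple N r M θ m) = Nat.card (MessageQuery N r M i m) :=
  Nat.card_congr (Equiv.ofBijective _
    ⟨NoiseTuple.query_injective hr hM i, NoiseTuple.query_surjective hr hM hm i⟩)

/-- Noise tuples biject with the queries of each server, so the count does not depend on the server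
and is the total `N ^ (M - 1)` divided by `N`. The auxiliary `θ` can be any message other than `m`.
-/
theorem card_messageQuery (hr : r ≤ N) (hM : 2 ≤ M) (m : Fin M) (i : Fin N) :
    Nat.card (MessageQuery N r M i m) = N ^ (M - 2) := by
  have : Nontrivial (Fin M) := Fin.nontrivial_iff_two_le.2 hM
  obtain ⟨θ, hθ⟩ := exists_ne m
  have h := sum_card_messageQuery hr hM m
  simp only [← card_noiseTuple hr hM hθ.symm] at h
  rw [Finset.sum_const, Finset.card_univ, Fintype.card_fin, smul_eq_mul,
    show M - 1 = (M - 2) + 1 by omega, pow_succ'] at h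
  rw [← card_noiseTuple hr hM hθ.symm]
  exact Nat.eq_of_mul_eq_mul_left i.pos h

/-- The queries that involve a message `m` can be labelled, bijectively for each server, in such a
way that the queries of a decoding group have a common label when `m` is not desired. -/
theorem exists_label (hN : 0 < N) (hr : r ≤ N) (hM : 2 ≤ M) (θ m : Fin M) :
    ∃ lab : ∀ i : Fin N, MessageQuery N r M i m ≃ Fin (N ^ (M - 2)),
      m ≠ θ → ∀ g ∈ groups N r M, ∀ (i i' : Fin N) (y : MessageQuery N r M i m)
        (y' : MessageQuery N r M i' m), (y.1.1 : ℕ) = g.2 i → (y'.1.1 : ℕ) = g.2 i' →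
        y.1.2.erase θ = y'.1.2.erase θ → (y.1.2.erase θ).card = g.1 → lab i y = lab i' y' := by
  classical
  by_cases hm : m = θ
  · exact ⟨fun i => Finite.equivFinOfCardEq (card_messageQuery hr hM m i), fun h => absurd hm h⟩
  · let E : ∀ i : Fin N, NoiseTuple N r M θ m ≃ MessageQuery N r M i m := fun i =>
      Equiv.ofBijective _
        ⟨NoiseTuple.query_injective hr hM i, NoiseTuple.query_surjective hr hM hm i⟩
    have hfin : Finite (NoiseTuple N r M θ m) := Finite.of_equiv _ (E ⟨0, hN⟩).symm
    let e : NoiseTuple N r M θ m ≃ Fin (N ^ (M - 2)) := Finite.equivFinOfCardEq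
      ((card_noiseTuple hr hM hm ⟨0, hN⟩).trans (card_messageQuery hr hM m _))
    refine ⟨fun i => (E i).symm.trans e, fun _ g hg i i' y y' hy hy' hS hcard => ?_⟩
    let p : NoiseTuple N r M θ m := ⟨(g, y.1.2.erase θ), hg, Finset.notMem_erase θ _, hcard,
      Finset.mem_erase.2 ⟨hm, y.2.2⟩⟩
    have h1 : (E i).symm y = p := (E i).symm_apply_eq.2 (p.query_eq hr hM i y hy rfl).symm
    have h2 : (E i').symm y' = p := (E i').symm_apply_eq.2 (p.query_eq hr hM i' y' hy' hS.symm).symm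
    rw [Equiv.trans_apply, Equiv.trans_apply, h1, h2]

end Labels

end PIR
namespace PIR

/-! ### Nonvanishing of polynomials over large finite fields. -/

section Polynomials

open MvPolynomial

variable {σ F : Type*} [Field F]

theorem totalDegree_det_le {m : Type*} [Fintype m] [DecidableEq m]
    (A : Matrix m m (MvPolynomial σ F)) (hA : ∀ i j, (A i j).totalDegree ≤ 1) :
    A.det.totalDegree ≤ Fintype.card m := by
  rw [Matrix.det_apply']
  refine totalDegree_finsetSum_le fun π _ => (totalDegree_mul _ _).trans ?_
  have h1 : (((Equiv.Perm.sign π : ℤˣ) : ℤ) : MvPolynomial σ F).totalDegree = 0 := by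
    rw [← map_intCast (C : F →+* MvPolynomial σ F), totalDegree_C]
  rw [h1, zero_add]
  refine (totalDegree_finsetProd _ _).trans ((Finset.sum_le_sum fun i _ => hA _ _).trans ?_)
  simp

theorem exists_eval_ne_zero [Finite σ] [Fintype F] (p : MvPolynomial σ F) (hp : p ≠ 0)
    (hd : p.totalDegree < Fintype.card F) : ∃ x, eval x p ≠ 0 := by
  by_contra! h
  exact hp (eq_zero_of_eval_zero_at_prod_finset p (fun _ => Finset.univ)
    (fun i => (degreeOf_le_totalDegree p i).trans_lt hd) fun x _ => h x)

theorem exists_forall_eval_ne_zero [Finite σ] [Fintype F] {ι : Type*} [Fintype ι]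
    (p : ι → MvPolynomial σ F) {d : ℕ} (hp : ∀ i, p i ≠ 0) (hd : ∀ i, (p i).totalDegree ≤ d)
    (hF : Fintype.card ι * d < Fintype.card F) : ∃ x, ∀ i, eval x (p i) ≠ 0 := by
  obtain ⟨x, hx⟩ := exists_eval_ne_zero (∏ i, p i) (Finset.prod_ne_zero_iff.2 fun i _ => hp i) (by
    refine ((totalDegree_finsetProd _ _).trans (Finset.sum_le_sum fun i _ => hd i)).trans_lt ?_
    simpa using hF)
  rw [map_prod] at hx
  exact ⟨x, fun i => Finset.prod_ne_zero_iff.1 hx i (Finset.mem_univ i)⟩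

theorem eval_det {m R : Type*} [Fintype m] [DecidableEq m] [CommRing R]
    (x : σ → R) (A : Matrix m m (MvPolynomial σ R)) :
    eval x A.det = (Matrix.of fun i j => eval x (A i j)).det := by
  rw [RingHom.map_det]
  rfl

end Polynomials

/-! ### The noise code and its check equations. -/

section NoiseCode

variable {F : Type*} [Field F]

theorem eq_zero_of_minors {ι : Type*} [Fintype ι] [DecidableEq ι] {N : ℕ}
    (A : Matrix ι (Fin N) F) (hA : ∀ s : ι ↪ Fin N, (A.submatrix id s).det ≠ 0)
    (J : Finset (Fin N)) (hJ : J.card = Fintype.card ι) (z : Fin N → F)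
    (hz : ∀ i, ∑ j, A i j * z j = 0) (hzJ : ∀ j ∉ J, z j = 0) : z = 0 := by
  have e : ι ≃ J := Fintype.equivOfCardEq (by simp [hJ])
  have h : (A.submatrix id (e.toEmbedding.trans (Function.Embedding.subtype _))).mulVec
      (fun i => z (e i)) = 0 := by
    ext i
    rw [Pi.zero_apply, ← hz i]
    simp only [Matrix.mulVec, dotProduct, Matrix.submatrix_apply, id]
    rw [← Finset.sum_subset (Finset.subset_univ J) fun j _ hj => by rw [hzJ j hj, mul_zero],
      ← Finset.sum_coe_sort J]
    exact Equiv.sum_comp e fun j => A i j * z j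
  have h0 := Matrix.eq_zero_of_mulVec_eq_zero (hA _) h
  ext j
  by_cases hj : j ∈ J
  · simpa using congrFun h0 (e.symm ⟨j, hj⟩)
  · exact hzJ j hj

-- Every minor is a polynomial in the entries of `h`, so for a large field it suffices that none of
-- them is the zero polynomial. This is seen by 0-1 specializations, which reduce the minors of the
-- second kind to products of minors of `G`.
open MvPolynomial in
theorem exists_generic_checks (N K n : ℕ) :
    ∃ q₀ : ℕ, ∀ (F : Type u) [Field F] [Fintype F], q₀ ≤ Fintype.card F →
      ∀ G : Matrix (Fin K) (Fin N) F, IsMDS G → ∃ h : Matrix (Fin n) (Fin N) F,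
        (∀ s : Fin n ↪ Fin N, (h.submatrix id s).det ≠ 0) ∧
        ∀ s : Fin K × Fin n ↪ Fin N,
          ((Matrix.of fun (x : Fin K × Fin n) j => G x.1 j * h x.2 j).submatrix id s).det ≠ 0 := by
  -- The number of minors times a common bound on their degrees, plus one.
  refine ⟨Fintype.card ((Fin n ↪ Fin N) ⊕ (Fin K × Fin n ↪ Fin N)) * (n + K * n) + 1,
    fun F _ _ hF G hG => ?_⟩
  let p : (Fin n ↪ Fin N) ⊕ (Fin K × Fin n ↪ Fin N) → MvPolynomial (Fin n × Fin N) F :=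
    Sum.elim (fun s => (Matrix.of fun a b => X (a, s b)).det)
      fun s => (Matrix.of fun (x y : Fin K × Fin n) => C (G x.1 (s y)) * X (x.2, s y)).det
  have hp : ∀ i, p i ≠ 0 := by
    classical
    rintro (s | s) h0
    · have h := congrArg (eval fun aj : Fin n × Fin N => if s aj.1 = aj.2 then (1 : F) else 0) h0
      simp only [p, Sum.elim_inl, eval_det, Matrix.of_apply, eval_X, map_zero] at h
      have h1 : (Matrix.of fun a b : Fin n => if s a = s b then (1 : F) else 0) = 1 := by
        ext a b
        simp [Matrix.one_apply]
      rw [h1, Matrix.det_one] at h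
      exact one_ne_zero h
    -- Row `a` of `h` becomes the indicator of the `K` columns `s (k, a)`. The minor is then block
    -- diagonal, with a maximal minor of `G` for each `a`.
    · have h := congrArg (eval fun aj : Fin n × Fin N =>
        if ∃ k, s (k, aj.1) = aj.2 then (1 : F) else 0) h0
      simp only [p, Sum.elim_inr, eval_det, Matrix.of_apply, eval_X, map_zero, map_mul, eval_C] at h
      have h1 : (Matrix.of fun x y : Fin K × Fin n => G x.1 (s y) *
          if ∃ k, s (k, x.2) = s y then (1 : F) else 0) =
          Matrix.blockDiagonal fun a => G.submatrix id fun k => s (k, a) := by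
        ext ⟨k, a⟩ ⟨k', a'⟩
        rw [Matrix.blockDiagonal_apply, Matrix.of_apply]
        by_cases ha : a = a'
        · subst ha
          simp
        · simp [ha]
      rw [h1, Matrix.det_blockDiagonal, Finset.prod_eq_zero_iff] at h
      obtain ⟨a, -, ha⟩ := h
      exact (hG.2 ⟨fun k => s (k, a), fun k k' hk => (Prod.mk.inj (s.injective hk)).1⟩).ne_zero ha
  have hd : ∀ i, (p i).totalDegree ≤ n + K * n := by
    rintro (s | s)
    · refine (totalDegree_det_le _ fun a b => ?_).trans (by simp)
      simp [totalDegree_X]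
    · refine (totalDegree_det_le _ fun a b => ?_).trans (by simp)
      refine (totalDegree_mul _ _).trans ?_
      simp [totalDegree_X]
  obtain ⟨x, hx⟩ := exists_forall_eval_ne_zero p hp hd (by omega)
  refine ⟨Matrix.of fun a j => x (a, j), fun s => ?_, fun s => ?_⟩
  · have h := hx (Sum.inl s)
    simp only [p, Sum.elim_inl, eval_det, Matrix.of_apply, eval_X] at h
    exact h
  · have h := hx (Sum.inr s)
    simp only [p, Sum.elim_inr, eval_det, Matrix.of_apply, eval_X, map_mul, eval_C] at h
    exact h

/-- The noise code is spanned by `T` independent vectors of the kernel of the `K n × N` product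
matrix. -/
theorem exists_noise_code (N K T n : ℕ) (hN : K * n + T = N) :
    ∃ q₀ : ℕ, ∀ (F : Type u) [Field F] [Fintype F], q₀ ≤ Fintype.card F →
      ∀ G : Matrix (Fin K) (Fin N) F, IsMDS G →
        ∃ (h : Matrix (Fin n) (Fin N) F) (v : Matrix (Fin T) (Fin N) F),
          (∀ s : Fin n ↪ Fin N, (h.submatrix id s).det ≠ 0) ∧
          (∀ t k a, ∑ j, G k j * h a j * v t j = 0) ∧
          ∀ J : Finset (Fin N), J.card = T → LinearIndependent F fun (j : J) t => v t j := by
  obtain ⟨q₀, hq₀⟩ := exists_generic_checks.{u} N K n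
  refine ⟨q₀, fun F _ _ hF G hG => ?_⟩
  obtain ⟨h, h1, h2⟩ := hq₀ F hF G hG
  set A : Matrix (Fin K × Fin n) (Fin N) F := Matrix.of fun x j => G x.1 j * h x.2 j with hA
  have hker : T ≤ Module.finrank F (LinearMap.ker A.mulVecLin) := by
    have h3 := LinearMap.finrank_range_add_finrank_ker A.mulVecLin
    have h4 := Submodule.finrank_le (LinearMap.range A.mulVecLin)
    simp only [Module.finrank_fintype_fun_eq_card, Fintype.card_prod, Fintype.card_fin] at h3 h4
    omega
  obtain ⟨v, hv⟩ := exists_linearIndependent_of_le_finrank hker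
  refine ⟨h, Matrix.of fun t => (v t : Fin N → F), h1, fun t k a => ?_, fun J hJ => ?_⟩
  · exact congrFun (LinearMap.mem_ker.1 (v t).2) (k, a)
  -- A kernel vector that vanishes on `J` is supported on the other `K n` columns, where the minor
  -- is invertible. So restriction to `J` keeps the `T` rows independent, and the columns of the
  -- resulting square matrix are independent as well.
  · have hinj : LinearMap.ker ((LinearMap.funLeft F F (Subtype.val : J → Fin N)).comp
        (LinearMap.ker A.mulVecLin).subtype) = ⊥ := by
      rw [LinearMap.ker_eq_bot']
      rintro ⟨z, hz⟩ hzJ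
      refine Subtype.ext (eq_zero_of_minors A h2 (Finset.univ \ J) ?_ z ?_ ?_)
      · rw [Finset.card_sdiff_of_subset (Finset.subset_univ J), Finset.card_univ, hJ]
        simp
        omega
      · exact fun x => congrFun (LinearMap.mem_ker.1 hz) x
      · intro j hj
        have hjJ : j ∈ J := by simpa using hj
        exact congrFun hzJ ⟨j, hjJ⟩
    have hrow := hv.map' _ hinj
    let e : Fin T ≃ J := (Fintype.equivFinOfCardEq (by simpa using hJ)).symm
    let B : Matrix (Fin T) (Fin T) F := Matrix.of fun t t' => (v t : Fin N → F) (e t')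
    have hB : IsUnit B := by
      rw [← Matrix.linearIndependent_rows_iff_isUnit]
      exact hrow.map' (LinearEquiv.funCongrLeft F F e).toLinearMap (LinearEquiv.ker _)
    have hcol := (Matrix.linearIndependent_cols_iff_isUnit.2 hB).comp e.symm e.symm.injective
    convert hcol using 2 with j
    ext t
    simp [B]

end NoiseCode

end PIR
namespace PIR

/-! ### Vectors in general position for all invertible matrices at once. -/

section GenericQueries

open MvPolynomial

/-- The indices of the vectors from which the queries about one message are formed. -/
abbrev VectorIndex (N K q : ℕ) : Type := Fin N × Fin K × Fin q

variable {N K q : ℕ}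

/-- The square matrix whose rows are the tensors of the columns of a code matrix with vectors. -/
def tensorMatrix {R : Type*} [CommRing R] (G : Matrix (Fin K) (Fin N) R)
    (e : VectorIndex N K q → Fin N × Fin q → R) :
    Matrix (VectorIndex N K q) (VectorIndex N K q) R :=
  Matrix.of fun a b => G b.2.1 a.1 * e a (b.1, b.2.2)

/-- Let `e (i, κ, z)` be the unit vector at `(j, z)`, where `j` is the server `κ` places before `i`.
The matrix splits into blocks indexed by `(j, z)`, each the transpose of a minor of `G` at `K`
cyclically consecutive servers. -/
theorem exists_tensorMatrix_det_ne_zero {F : Type*} [Field F] {G : Matrix (Fin K) (Fin N) F}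
    (hG : IsMDS G) (q : ℕ) :
    ∃ e : VectorIndex N K q → Fin N × Fin q → F, (tensorMatrix G e).det ≠ 0 := by
  classical
  refine ⟨fun a s => if a.1 = cyc s.1 a.2.1 ∧ a.2.2 = s.2 then 1 else 0, fun h0 => ?_⟩
  obtain ⟨c, hc, hc0⟩ := Matrix.exists_vecMul_eq_zero_iff.2 h0
  refine hc (funext fun ⟨i, κ, z⟩ => ?_)
  obtain ⟨j, rfl⟩ := (cyc_bijective (κ : ℕ)).2 i
  let s : Fin K ↪ Fin N := ⟨fun κ => cyc j κ, fun κ κ' h => Fin.ext (by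
    have h1 := congrArg (stepsLeft j) h
    dsimp only at h1
    rwa [stepsLeft_cyc j (κ.2.trans_le hG.1), stepsLeft_cyc j (κ'.2.trans_le hG.1)] at h1)⟩
  have hs : (G.submatrix id s).mulVec (fun κ => c (cyc j κ, κ, z)) = 0 := by
    ext k
    have h1 := congrFun hc0 (j, k, z)
    rw [Pi.zero_apply] at h1 ⊢
    rw [← h1]
    simp only [Matrix.mulVec, Matrix.vecMul, dotProduct, tensorMatrix, Matrix.of_apply,
      Matrix.submatrix_apply, id, Fintype.sum_prod_type]
    rw [Finset.sum_comm]
    refine Finset.sum_congr rfl fun κ _ => ?_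
    rw [Finset.sum_eq_single (cyc j κ), Finset.sum_eq_single z]
    · simp only [and_self, if_true, mul_one]
      exact mul_comm _ _
    · intro z' _ hz
      simp [hz]
    · simp
    · intro i _ hi
      refine Finset.sum_eq_zero fun z' _ => ?_
      simp [hi]
    · simp
  exact congrFun (Matrix.eq_zero_of_mulVec_eq_zero (hG.2 s).ne_zero hs) κ

/-- The determinant of the tensor matrix of `γ • e`, as a polynomial in the entries of `e`. -/
noncomputable def tensorPolynomial {F : Type*} [Field F] (G : Matrix (Fin K) (Fin N) F)
    (γ : Matrix (VectorIndex N K q) (VectorIndex N K q) F) :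
    MvPolynomial (VectorIndex N K q × (Fin N × Fin q)) F :=
  (tensorMatrix (Matrix.of fun k i => C (G k i)) fun a s => ∑ b, C (γ a b) * X (b, s)).det

theorem aeval_tensorPolynomial {F E : Type*} [Field F] [Field E] [Algebra F E]
    (G : Matrix (Fin K) (Fin N) F) (γ : Matrix (VectorIndex N K q) (VectorIndex N K q) F)
    (x : VectorIndex N K q × (Fin N × Fin q) → E) :
    aeval x (tensorPolynomial G γ) =
      (tensorMatrix (Matrix.of fun k i => algebraMap F E (G k i))
        fun a s => ∑ b, algebraMap F E (γ a b) * x (b, s)).det := by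
  rw [tensorPolynomial, AlgHom.map_det]
  congr 1
  ext a b
  simp [tensorMatrix]

/-- Substituting `γ⁻¹ e` undoes `γ` and leaves the determinant for `e`. -/
theorem tensorPolynomial_ne_zero {F : Type*} [Field F] {G : Matrix (Fin K) (Fin N) F}
    (hG : IsMDS G) (γ : (Matrix (VectorIndex N K q) (VectorIndex N K q) F)ˣ) :
    tensorPolynomial G γ.val ≠ 0 := by
  obtain ⟨e, he⟩ := exists_tensorMatrix_det_ne_zero hG q
  intro h0
  have h := aeval_tensorPolynomial (E := F) G γ.val fun p => ∑ b, (γ⁻¹).val p.1 b * e b p.2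
  rw [h0, map_zero] at h
  refine he (Eq.trans ?_ h.symm)
  congr 2
  ext a s
  have h1 : (γ.val * ((γ⁻¹).val * Matrix.of e)) a s = e a s := by
    rw [← Matrix.mul_assoc, Units.mul_inv, Matrix.one_mul]
    rfl
  rw [← h1]
  rfl

/-- There are vectors over `F` (coming from generic vectors over a finite extension field) such
that the images of any invertible combinations have linearly independent responses. -/
theorem exists_generic_vectors {F : Type*} [Field F] [Finite F] {G : Matrix (Fin K) (Fin N) F}
    (hG : IsMDS G) (q : ℕ) :
    ∃ (d : ℕ) (U : Fin d → VectorIndex N K q → Fin (d * (N * q)) → F), 0 < d ∧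
      ∀ γ : (Matrix (VectorIndex N K q) (VectorIndex N K q) F)ˣ,
        LinearIndependent F fun (p : Fin d × VectorIndex N K q) (k : Fin K) j =>
          G k p.2.1 * ∑ b, γ.val p.2 b * U p.1 b j := by
  classical
  have : Fintype (Matrix (VectorIndex N K q) (VectorIndex N K q) F)ˣ := Fintype.ofFinite _
  -- The product over the finitely many `γ` is a nonzero polynomial, so over an infinite field it
  -- has a point that is not a root.
  obtain ⟨x, hx⟩ : ∃ x : VectorIndex N K q × (Fin N × Fin q) → AlgebraicClosure F,
      aeval x (∏ γ : (Matrix (VectorIndex N K q) (VectorIndex N K q) F)ˣ,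
        tensorPolynomial G γ.val) ≠ 0 := by
    by_contra! h
    have h1 : map (algebraMap F (AlgebraicClosure F)) (∏ γ :
        (Matrix (VectorIndex N K q) (VectorIndex N K q) F)ˣ, tensorPolynomial G γ.val) = 0 := by
      refine MvPolynomial.funext fun x => ?_
      rw [map_zero, eval_map, ← aeval_def, h]
    rw [map_eq_zero_iff _ (map_injective _ (algebraMap F (AlgebraicClosure F)).injective)] at h1
    exact Finset.prod_ne_zero_iff.2 (fun γ _ => tensorPolynomial_ne_zero hG γ) h1
  set E := IntermediateField.adjoin F (Set.range x) with hE
  have : FiniteDimensional F E := IntermediateField.finiteDimensional_adjoin fun y _ =>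
    (Algebra.IsAlgebraic.isAlgebraic y).isIntegral
  let y : VectorIndex N K q × (Fin N × Fin q) → E := fun p =>
    ⟨x p, IntermediateField.subset_adjoin F _ ⟨p, rfl⟩⟩
  have hy : ∀ γ : (Matrix (VectorIndex N K q) (VectorIndex N K q) F)ˣ,
      aeval y (tensorPolynomial G γ.val) ≠ 0 := by
    intro γ h
    rw [map_prod, Finset.prod_ne_zero_iff] at hx
    refine hx γ (Finset.mem_univ γ) ?_
    have h1 : x = algebraMap E (AlgebraicClosure F) ∘ y := rfl
    rw [h1, aeval_algebraMap_apply, h, map_zero]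
  let β := Module.finBasis F E
  let idx : Fin (Module.finrank F E) × (Fin N × Fin q) ≃ Fin (Module.finrank F E * (N * q)) :=
    (Equiv.prodCongr (Equiv.refl _) finProdFinEquiv).trans finProdFinEquiv
  -- System `δ` consists of the coordinates over `F` of the generic vectors multiplied by the basis
  -- element `β δ`.
  refine ⟨Module.finrank F E, fun δ b j =>
    β.repr (β δ * y (b, (idx.symm j).2)) (idx.symm j).1, Module.finrank_pos, fun γ => ?_⟩
  have hrow : LinearIndependent E (tensorMatrix (Matrix.of fun k i => algebraMap F E (G k i))
        fun a s => ∑ b, algebraMap F E (γ.val a b) * y (b, s)).row := by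
    rw [Matrix.linearIndependent_rows_iff_isUnit, Matrix.isUnit_iff_isUnit_det, isUnit_iff_ne_zero,
      ← aeval_tensorPolynomial]
    exact hy γ
  -- Multiples of `E`-independent vectors by an `F`-basis of `E` are `F`-independent. The map `Ψ`
  -- reassembles coordinates into elements of `E`, so this independence descends to the coordinate
  -- vectors.
  have hsmul := linearIndependent_smul β.linearIndependent hrow
  let Ψ : (Fin K → Fin (Module.finrank F E * (N * q)) → F) →ₗ[F] (VectorIndex N K q → E) :=
    { toFun := fun Y b => ∑ δ, Y b.2.1 (idx (δ, (b.1, b.2.2))) • β δ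
      map_add' := fun Y Z => by
        ext1 b
        simp [add_smul, Finset.sum_add_distrib]
      map_smul' := fun c Y => by
        ext1 b
        simp [mul_smul, Finset.smul_sum] }
  refine LinearIndependent.of_comp Ψ ?_
  convert hsmul using 1
  funext ⟨δ, a⟩ b
  set w : E := G b.2.1 a.1 • ∑ b', γ.val a b' • (β δ * y (b', (b.1, b.2.2))) with hw
  have h1 : (β δ • (tensorMatrix (Matrix.of fun k i => algebraMap F E (G k i))
      fun a s => ∑ b, algebraMap F E (γ.val a b) * y (b, s)).row a) b = w := by
    rw [hw]
    simp only [Pi.smul_apply, Matrix.row, tensorMatrix, Matrix.of_apply, Algebra.smul_def,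
      Finset.mul_sum, Algebra.algebraMap_self, RingHom.id_apply]
    refine Finset.sum_congr rfl fun b' _ => ?_
    ring
  have h2 : ∀ δ', β.repr w δ' =
      G b.2.1 a.1 * ∑ b', γ.val a b' * β.repr (β δ * y (b', (b.1, b.2.2))) δ' := by
    intro δ'
    simp [hw, map_sum]
  dsimp only
  rw [h1, ← β.sum_repr w]
  simp only [Ψ, Function.comp_apply, LinearMap.coe_mk, AddHom.coe_mk, Equiv.symm_apply_apply, h2]

end GenericQueries

end PIR
namespace PIR

/-! ### Responses as linear functionals of the messages. -/

section Responses

variable {F : Type u} [Field F] {K N M ℓ : ℕ}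

/-- The combinations of the `k`-th blocks of the messages that a query prescribes. -/
def blockResponse (W : Messages F K M ℓ) (k : Fin K) (q : Query F M ℓ) : F :=
  ∑ m, ∑ j, W m k j * q m j

theorem response_eq_sum_blockResponse (G : Matrix (Fin K) (Fin N) F) (W : Messages F K M ℓ)
    (i : Fin N) (q : Query F M ℓ) : response G W i q = ∑ k, G k i * blockResponse W k q := by
  simp only [response, stored, blockResponse, Finset.mul_sum, Finset.sum_mul]
  conv_rhs => rw [Finset.sum_comm]
  refine Finset.sum_congr rfl fun m _ => ?_
  rw [Finset.sum_comm]
  refine Finset.sum_congr rfl fun k _ => Finset.sum_congr rfl fun j _ => ?_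
  ring

theorem response_add (G : Matrix (Fin K) (Fin N) F) (W : Messages F K M ℓ) (i : Fin N)
    (q q' : Query F M ℓ) : response G W i (q + q') = response G W i q + response G W i q' := by
  simp [response, mul_add, Finset.sum_add_distrib]

theorem response_zero (G : Matrix (Fin K) (Fin N) F) (W : Messages F K M ℓ) (i : Fin N) :
    response G W i 0 = 0 := by
  simp [response]

theorem response_sub_left (G : Matrix (Fin K) (Fin N) F) (W W' : Messages F K M ℓ) (i : Fin N)
    (q : Query F M ℓ) : response G (W - W') i q = response G W i q - response G W' i q := by
  simp [response, stored, mul_sub, sub_mul, Finset.sum_sub_distrib]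

theorem blockResponse_sum_smul {T : ℕ} (W : Messages F K M ℓ) (k : Fin K) (c : Fin T → F)
    (w : Fin T → Query F M ℓ) :
    blockResponse W k (∑ t, c t • w t) = ∑ t, c t * blockResponse W k (w t) := by
  simp only [blockResponse, Finset.sum_apply, Pi.smul_apply, smul_eq_mul, Finset.mul_sum]
  conv_rhs => rw [Finset.sum_comm]
  refine Finset.sum_congr rfl fun m _ => ?_
  conv_rhs => rw [Finset.sum_comm]
  refine Finset.sum_congr rfl fun j _ => Finset.sum_congr rfl fun t _ => ?_
  ring

/-- The responses to noise queries satisfy the check equations `h`. -/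
theorem sum_check_mul_response {T n : ℕ} {G : Matrix (Fin K) (Fin N) F}
    {h : Matrix (Fin n) (Fin N) F} {v : Matrix (Fin T) (Fin N) F}
    (hv : ∀ t k a, ∑ j, G k j * h a j * v t j = 0) (W : Messages F K M ℓ)
    (w : Fin T → Query F M ℓ) (a : Fin n) :
    ∑ i, h a i * response G W i (∑ t, v t i • w t) = 0 := by
  simp only [response_eq_sum_blockResponse, blockResponse_sum_smul, Finset.mul_sum]
  rw [Finset.sum_comm]
  refine Finset.sum_eq_zero fun k _ => ?_
  rw [Finset.sum_comm]
  refine Finset.sum_eq_zero fun t _ => ?_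
  have h1 : ∑ i, h a i * (G k i * (v t i * blockResponse W k (w t))) =
      (∑ j, G k j * h a j * v t j) * blockResponse W k (w t) := by
    rw [Finset.sum_mul]
    refine Finset.sum_congr rfl fun i _ => ?_
    ring
  rw [h1, hv, zero_mul]

theorem response_of_support {G : Matrix (Fin K) (Fin N) F} (W : Messages F K M ℓ) (i : Fin N)
    {θ : Fin M} {q : Query F M ℓ} (hq : ∀ m ≠ θ, q m = 0) :
    response G W i q = ∑ k, ∑ j, W θ k j * (G k i * q θ j) := by
  rw [response_eq_sum_blockResponse]
  refine Finset.sum_congr rfl fun k _ => ?_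
  rw [blockResponse, Finset.sum_eq_single θ, Finset.mul_sum]
  · refine Finset.sum_congr rfl fun j _ => ?_
    ring
  · intro m _ hm
    simp [hq m hm]
  · simp

/-- Responses to queries about one message are linearly independent if the tensors of the columns
of the code matrix with the queries are. -/
theorem linearIndependent_response {ι : Type*} (G : Matrix (Fin K) (Fin N) F) (θ : Fin M)
    (s : ι → Fin N) (q : ι → Query F M ℓ) (hq : ∀ x, ∀ m ≠ θ, q x m = 0)
    (h : LinearIndependent F fun (x : ι) (k : Fin K) (j : Fin ℓ) => G k (s x) * q x θ j) :
    LinearIndependent F fun (x : ι) (W : Messages F K M ℓ) => response G W (s x) (q x) := by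
  classical
  -- Evaluation at the messages with a single nonzero symbol reads off the tensor.
  let Φ : (Messages F K M ℓ → F) →ₗ[F] (Fin K → Fin ℓ → F) :=
    { toFun := fun f k j => f (Pi.single θ (Pi.single k (Pi.single j 1)))
      map_add' := fun _ _ => rfl
      map_smul' := fun _ _ => rfl }
  refine LinearIndependent.of_comp Φ ?_
  convert h using 1
  funext x k j
  simp only [Φ, Function.comp_apply, LinearMap.coe_mk, AddHom.coe_mk]
  rw [response_of_support _ _ (hq x), Finset.sum_eq_single k, Finset.sum_eq_single j]
  · simp
  · intro j' _ hj
    simp [hj]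
  · simp
  · intro k' _ hk
    refine Finset.sum_eq_zero fun j' _ => ?_
    simp [hk]
  · simp

theorem IsMDS.exists_ne_zero {G : Matrix (Fin K) (Fin N) F} (hG : IsMDS G) (hK : 1 ≤ K)
    (i : Fin N) : ∃ k, G k i ≠ 0 := by
  by_contra! h
  let s : Fin K ↪ Fin N := ⟨fun κ => cyc i κ, fun κ κ' h => Fin.ext (by
    have h1 := congrArg (stepsLeft i) h
    dsimp only at h1
    rwa [stepsLeft_cyc i (κ.2.trans_le hG.1), stepsLeft_cyc i (κ'.2.trans_le hG.1)] at h1)⟩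
  refine (hG.2 s).ne_zero (Matrix.det_eq_zero_of_column_eq_zero ⟨0, hK⟩ fun k => ?_)
  have h0 : s ⟨0, hK⟩ = i := Fin.ext (Nat.mod_eq_of_lt i.2)
  rw [Matrix.submatrix_apply, h0]
  exact h k

end Responses

/-! ### The one-shot scheme. -/

section OneShot

variable {F : Type u} [Field F] {K N M T n : ℕ}

theorem eq_zero_of_linearIndependent {J : Finset (Fin N)} (hJ : J.card = T)
    {v : Matrix (Fin T) (Fin N) F} (hv : LinearIndependent F fun (j : J) t => v t j)
    (x : Fin T → F) (hx : ∀ j ∈ J, ∑ t, v t j * x t = 0) : x = 0 := by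
  let e : Fin T ≃ J := (Fintype.equivFinOfCardEq (by simpa using hJ)).symm
  let B : Matrix (Fin T) (Fin T) F := Matrix.of fun j t => v t (e j)
  have hB : IsUnit B := Matrix.linearIndependent_rows_iff_isUnit.1 (hv.comp e e.injective)
  refine Matrix.eq_zero_of_mulVec_eq_zero ((Matrix.isUnit_iff_isUnit_det B).1 hB).ne_zero
    (funext fun j => ?_)
  exact hx _ (e j).2

/-- The last `n` columns of `h` form an invertible matrix, so the checks can be solved for the last
`n` coordinates. -/
theorem exists_decoding_coeff {r : ℕ} (hr : r + n = N) {h : Matrix (Fin n) (Fin N) F}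
    (hh : ∀ s : Fin n ↪ Fin N, (h.submatrix id s).det ≠ 0) :
    ∃ coeff : Fin N → Fin N → F, ∀ z : Fin N → F, (∀ a, ∑ j, h a j * z j = 0) →
      ∀ i : Fin N, r ≤ (i : ℕ) →
        z i = ∑ j ∈ Finset.univ.filter (fun j : Fin N => (j : ℕ) < r), coeff i j * z j := by
  classical
  let s : Fin n ↪ Fin N := ⟨fun b => ⟨r + b, by omega⟩, fun b b' hb => Fin.ext (by
    have := congrArg Fin.val hb
    dsimp only at this
    omega)⟩
  set B := h.submatrix id s with hB
  refine ⟨fun i j => if hi : r ≤ (i : ℕ) then -∑ a, B⁻¹ ⟨i - r, by omega⟩ a * h a j else 0,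
    fun z hz i hi => ?_⟩
  have h1 : B.mulVec (fun b => z (s b)) =
      fun a => -∑ j ∈ Finset.univ.filter (fun j : Fin N => (j : ℕ) < r), h a j * z j := by
    funext a
    rw [eq_neg_iff_add_eq_zero, ← hz a, ← Finset.sum_filter_add_sum_filter_not Finset.univ
      (fun j : Fin N => (j : ℕ) < r) (fun j => h a j * z j), add_comm]
    congr 1
    rw [Matrix.mulVec, dotProduct]
    refine Finset.sum_bij (fun b _ => s b) ?_ ?_ ?_ ?_
    · intro b _
      rw [Finset.mem_filter, not_lt]
      exact ⟨Finset.mem_univ _, Nat.le_add_right r b⟩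
    · intro b _ b' _ hb
      exact s.injective hb
    · intro j hj
      rw [Finset.mem_filter, not_lt] at hj
      exact ⟨⟨j - r, by omega⟩, Finset.mem_univ _, Fin.ext (by
        change r + (j - r) = (j : ℕ)
        omega)⟩
    · intro b _
      rfl
  have h2 : (fun b => z (s b)) = B⁻¹.mulVec (B.mulVec fun b => z (s b)) := by
    rw [Matrix.mulVec_mulVec, Matrix.nonsing_inv_mul _ (hh s).isUnit, Matrix.one_mulVec]
  have h3 := congrFun h2 ⟨i - r, by omega⟩
  have h4 : s ⟨i - r, by omega⟩ = i := Fin.ext (by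
    change r + (i - r) = (i : ℕ)
    omega)
  rw [h4, h1] at h3
  rw [h3]
  simp only [Matrix.mulVec, dotProduct, dif_pos hi, neg_mul, Finset.sum_mul, Finset.mul_sum,
    mul_neg, Finset.sum_neg_distrib]
  rw [Finset.sum_comm]
  simp only [mul_assoc]

variable [Fintype F]

/-- The one-shot scheme with noise from the code `v`, which satisfies the checks `h`. -/
noncomputable def oneShotScheme {r ℓ : ℕ} {G : Matrix (Fin K) (Fin N) F} (hG : IsMDS G)
    (hK : 1 ≤ K) (hℓ : N ≤ ℓ) {h : Matrix (Fin n) (Fin N) F} {v : Matrix (Fin T) (Fin N) F}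
    (hv : ∀ t k a, ∑ j, G k j * h a j * v t j = 0)
    (hvJ : ∀ J : Finset (Fin N), J.card = T → LinearIndependent F fun (j : J) t => v t j)
    (coeff : Fin N → Fin N → F)
    (hcoeff : ∀ z : Fin N → F, (∀ a, ∑ j, h a j * z j = 0) → ∀ i : Fin N, r ≤ (i : ℕ) →
        z i = ∑ j ∈ Finset.univ.filter (fun j : Fin N => (j : ℕ) < r), coeff i j * z j) :
    OneShotScheme G T M r ℓ where
  Ω := Fin T → Query F M ℓ
  weight := fun _ => (Fintype.card (Fin T → Query F M ℓ) : ℝ)⁻¹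
  weight_nonneg := fun _ => by positivity
  weight_sum := by
    rw [Finset.sum_const, Finset.card_univ, nsmul_eq_mul, mul_inv_cancel₀]
    exact_mod_cast Fintype.card_ne_zero
  q := fun w i => ∑ t, v t i • w t
  -- Distinct servers query distinct coordinates, which makes the responses independent; this is
  -- where `N ≤ ℓ` enters.
  a := fun θ i => if (i : ℕ) < r then 0 else Pi.single θ (Pi.single (Fin.castLE hℓ i) 1)
  a_noise := fun θ i hi => if_pos hi
  a_mem := fun θ i m hm => by
    split_ifs
    · rfl
    · exact Pi.single_eq_of_ne hm _
  uniform := fun θ J hJ y => by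
    -- At `T` servers the noise is an invertible transform of `T` uniform queries, and adding the
    -- fixed `a θ i` keeps the map bijective.
    rw [law_of_bijective, Fintype.card_fun, Fintype.card_fin, Nat.cast_pow]
    rw [Fintype.bijective_iff_injective_and_card]
    constructor
    · intro w w' hw
      rw [← sub_eq_zero]
      funext t m j
      have h0 := eq_zero_of_linearIndependent hJ (hvJ J hJ) (fun t => (w - w') t m j)
        fun i hi => by
          have h1 := congrFun (congrFun (congrFun hw ⟨i, hi⟩) m) j
          simp only [Pi.add_apply, Finset.sum_apply, Pi.smul_apply, smul_eq_mul,
            add_left_inj] at h1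
          simp only [Pi.sub_apply, mul_sub, Finset.sum_sub_distrib, h1, sub_self]
      exact congrFun h0 t
    · simp [hJ]
  independent := fun θ => by
    refine linearIndependent_response G θ
      (fun i : {i : Fin N // r ≤ (i : ℕ)} => (i : Fin N)) _ ?_ ?_
    · intro i m hm
      rw [if_neg (not_lt.2 i.2)]
      exact Pi.single_eq_of_ne hm _
    · rw [Fintype.linearIndependent_iff]
      intro c hc i
      obtain ⟨k, hk⟩ := hG.exists_ne_zero hK i
      have h1 := congrFun (congrFun hc k) (Fin.castLE hℓ i)
      rw [Finset.sum_apply, Finset.sum_apply, Finset.sum_eq_single i] at h1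
      · simpa [if_neg (not_lt.2 i.2), hk] using h1
      · intro i' _ hi'
        have h2 : (Fin.castLE hℓ (i : Fin N)) ≠ Fin.castLE hℓ (i' : Fin N) := fun h3 =>
          hi' (Subtype.ext (Fin.castLE_injective hℓ h3).symm)
        simp [if_neg (not_lt.2 i'.2), h2]
      · simp
  coeff := coeff
  decoding := fun w _ W i hi => hcoeff _ (sum_check_mul_response hv W w) i hi

end OneShot

end PIR
namespace PIR

/-! ### Transitivity of invertible matrices on independent families. -/

section Transitivity

variable {F : Type*} [Field F]

/-- Any two linearly independent families of the same length are related by an invertible matrix. -/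
theorem exists_vecMul_eq {ι A : Type*} [Finite ι] [Fintype A] [DecidableEq A] {x y : ι → A → F}
    (hx : LinearIndependent F x) (hy : LinearIndependent F y) :
    ∃ g : (Matrix A A F)ˣ, ∀ i, Matrix.vecMul (y i) g.val = x i := by
  -- The isomorphism between the two spans extends to an automorphism of the whole space.
  obtain ⟨f, hf⟩ := Submodule.exists_linearEquiv_restrict_eq
    ((Module.Basis.span hy).equiv (Module.Basis.span hx) (Equiv.refl ι))
  have hf' : ∀ i, f (y i) = x i := by
    intro i
    have h := hf (Module.Basis.span hy i)
    rw [Module.Basis.equiv_apply, Module.Basis.span_apply, Module.Basis.span_apply] at h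
    exact h.symm
  let P := LinearMap.toMatrix' f.toLinearMap
  let P' := LinearMap.toMatrix' f.symm.toLinearMap
  have h1 : P * P' = 1 := by
    rw [← LinearMap.toMatrix'_comp]
    simp
  have h2 : P' * P = 1 := by
    rw [← LinearMap.toMatrix'_comp]
    simp
  refine ⟨⟨P.transpose, P'.transpose, by rw [← Matrix.transpose_mul, h2, Matrix.transpose_one],
    by rw [← Matrix.transpose_mul, h1, Matrix.transpose_one]⟩, fun i => ?_⟩
  rw [← hf' i]
  change Matrix.vecMul (y i) P.transpose = _
  rw [Matrix.vecMul_transpose, LinearMap.toMatrix'_mulVec]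
  rfl

end Transitivity

theorem Scheme.private_of_law {F : Type u} [Field F] [Fintype F] {N M ℓ T : ℕ} {P : Fin N → Type}
    [∀ i, Fintype (P i)] (Q : Scheme F M ℓ P) (θ₀ : Fin M)
    (h : ∀ J : Finset (Fin N), J.card = T → ∀ θ y,
      law Q.weight (fun ω => fun i : J => Q.query θ ω i) y =
        law Q.weight (fun ω => fun i : J => Q.query θ₀ ω i) y) : Q.Private T := by
  classical
  intro J hJ
  exact mutualInfo_index_eq_zero θ₀.pos.ne' Q.weight Q.weight_sum
    (fun s => fun i : J => Q.query s.1 s.2 i) _ (h J hJ)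

/-! ### The lifted scheme and its privacy. -/

section Lifted

variable {F : Type u} [Field F] {N K T M r q d ℓ : ℕ}

/-- The coefficient matrices: the query to server `i` about message `m` is formed from the vectors
with server index `j` by row `i` of this matrix. It is the identity for the desired message,
and the code `v` for the others. -/
def mixing (v : Matrix (Fin T) (Fin N) F) (θ m : Fin M) : Matrix (Fin N) (Fin N) F :=
  if m = θ then 1 else Matrix.of fun i j => ∑ t, v t i * if (t : ℕ) = (j : ℕ) then 1 else 0

/-- A row of the Kronecker product of a matrix with an identity matrix. -/
def kroneckerRow (b : Fin N → F) (p : Fin K × Fin q) : VectorIndex N K q → F :=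
  fun a => if a.2 = p then b a.1 else 0

/-- The first case concerns rows of the identity. In the second, the first `T` coordinates are the
columns of `v` at `J`. -/
theorem linearIndependent_mixing (hTN : T ≤ N) {v : Matrix (Fin T) (Fin N) F}
    {J : Finset (Fin N)} (hv : LinearIndependent F fun (j : J) t => v t j) (θ m : Fin M) :
    LinearIndependent F fun j : J => mixing v θ m j := by
  unfold mixing
  split_ifs
  · have h : LinearIndependent F (1 : Matrix (Fin N) (Fin N) F).row :=
      Matrix.linearIndependent_rows_iff_isUnit.2 isUnit_one
    exact h.comp (fun j : J => (j : Fin N)) Subtype.val_injective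
  · refine LinearIndependent.of_comp (LinearMap.funLeft F F (Fin.castLE hTN)) ?_
    convert hv using 1
    funext j t
    simp only [Function.comp_apply, LinearMap.funLeft_apply, Matrix.of_apply, Fin.val_castLE]
    rw [Finset.sum_eq_single t]
    · simp
    · intro t' _ ht
      simp [Fin.val_ne_of_ne ht]
    · simp

theorem linearIndependent_kroneckerRow {ι : Type*} [Fintype ι] {b : ι → Fin N → F}
    (hb : LinearIndependent F b) :
    LinearIndependent F fun x : ι × (Fin K × Fin q) => kroneckerRow (b x.1) x.2 := by
  classical
  rw [Fintype.linearIndependent_iff] at hb ⊢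
  rintro c hc ⟨i, p⟩
  refine hb (fun i => c (i, p)) (funext fun j => ?_) i
  have h := congrFun hc (j, p)
  rw [Finset.sum_apply, Fintype.sum_prod_type] at h
  refine Eq.trans ?_ h
  rw [Finset.sum_apply]
  refine Finset.sum_congr rfl fun i _ => ?_
  rw [Finset.sum_eq_single p]
  · simp [kroneckerRow]
  · intro p' _ hp
    simp [kroneckerRow, hp.symm]
  · simp

theorem kroneckerRow_mixing_self (v : Matrix (Fin T) (Fin N) F) (θ : Fin M) (i : Fin N)
    (p : Fin K × Fin q) : kroneckerRow (mixing v θ θ i) p = Pi.single (i, p) 1 := by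
  funext a
  obtain ⟨j, p'⟩ := a
  rw [kroneckerRow, mixing, if_pos rfl, Matrix.one_apply, Pi.single_apply]
  by_cases h1 : p' = p <;> by_cases h2 : i = j
  · simp [h1, h2]
  · simp [h2, Ne.symm h2]
  · simp [h1]
  · simp [h1]

/-- The vector with coefficients `x` with respect to `γ` applied to the given vectors. -/
def combine (U : VectorIndex N K q → Fin ℓ → F)
    (γ : (Matrix (VectorIndex N K q) (VectorIndex N K q) F)ˣ) (x : VectorIndex N K q → F) :
    Fin ℓ → F :=
  ∑ b, Matrix.vecMul x γ.val b • U b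

theorem combine_sum_smul {ι : Type*} (s : Finset ι) (U : VectorIndex N K q → Fin ℓ → F)
    (γ : (Matrix (VectorIndex N K q) (VectorIndex N K q) F)ˣ) (c : ι → F)
    (x : ι → VectorIndex N K q → F) :
    combine U γ (∑ t ∈ s, c t • x t) = ∑ t ∈ s, c t • combine U γ (x t) := by
  simp only [combine, Finset.smul_sum, Matrix.sum_vecMul, Matrix.smul_vecMul, Finset.sum_apply,
    Pi.smul_apply, Finset.sum_smul, smul_eq_mul, mul_smul]
  rw [Finset.sum_comm]

theorem combine_mul (U : VectorIndex N K q → Fin ℓ → F)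
    (g γ : (Matrix (VectorIndex N K q) (VectorIndex N K q) F)ˣ) (x : VectorIndex N K q → F) :
    combine U (g * γ) x = combine U γ (Matrix.vecMul x g.val) := by
  unfold combine
  rw [Units.val_mul, Matrix.vecMul_vecMul]

variable [Fintype F]

/-- The query of a round that involves message `m`, without its round. -/
def LiftIndex.messageQuery {c : ℕ} {i : Fin N} (x : LiftIndex N r M c i) {m : Fin M}
    (hm : m ∈ x.1.2.2) : MessageQuery N r M i m :=
  ⟨x.1.2, x.2, hm⟩

open Classical in
/-- The scheme lifted from the noise code `v`: for every message, a random invertible matrix is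
applied to the given vectors. -/
noncomputable def liftedScheme (v : Matrix (Fin T) (Fin N) F)
    (lab : ∀ (_ m : Fin M) (i : Fin N), MessageQuery N r M i m ≃ Fin q)
    (U : Fin d → VectorIndex N K q → Fin ℓ → F) : Scheme F M ℓ (LiftIndex N r M (K * d)) where
  Ω := Fin M → (Matrix (VectorIndex N K q) (VectorIndex N K q) F)ˣ
  weight := fun _ =>
    (Fintype.card (Fin M → (Matrix (VectorIndex N K q) (VectorIndex N K q) F)ˣ) : ℝ)⁻¹
  weight_nonneg := fun _ => by positivity
  weight_sum := by
    rw [Finset.sum_const, Finset.card_univ, nsmul_eq_mul, mul_inv_cancel₀]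
    exact_mod_cast Fintype.card_ne_zero
  -- The round is a pair in `Fin K × Fin d`: the first component enters the coefficient row, the
  -- second selects the system of vectors.
  query := fun θ ω i x m =>
    if hm : m ∈ x.1.2.2 then
      combine (U (finProdFinEquiv.symm x.1.1).2) (ω m) (kroneckerRow (mixing v θ m i)
        ((finProdFinEquiv.symm x.1.1).1, lab θ m i (x.messageQuery hm)))
    else 0

variable {v : Matrix (Fin T) (Fin N) F}
  {lab : ∀ (_ m : Fin M) (i : Fin N), MessageQuery N r M i m ≃ Fin q}
  {U : Fin d → VectorIndex N K q → Fin ℓ → F}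

theorem liftedScheme_query_of_mem (θ : Fin M) (ω : (liftedScheme v lab U).Ω) (i : Fin N)
    (x : LiftIndex N r M (K * d) i) {m : Fin M} (hm : m ∈ x.1.2.2) :
    (liftedScheme v lab U).query θ ω i x m =
      combine (U (finProdFinEquiv.symm x.1.1).2) (ω m) (kroneckerRow (mixing v θ m i)
        ((finProdFinEquiv.symm x.1.1).1, lab θ m i (x.messageQuery hm))) :=
  dif_pos hm

theorem liftedScheme_query_of_notMem (θ : Fin M) (ω : (liftedScheme v lab U).Ω) (i : Fin N)
    (x : LiftIndex N r M (K * d) i) {m : Fin M} (hm : m ∉ x.1.2.2) :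
    (liftedScheme v lab U).query θ ω i x m = 0 :=
  dif_neg hm

/-- The desired components are the rows of `ω θ` applied to the given vectors. -/
theorem liftedScheme_query_desired (θ : Fin M) (ω : (liftedScheme v lab U).Ω) (i : Fin N)
    (x : LiftIndex N r M (K * d) i) (hm : θ ∈ x.1.2.2) (j : Fin ℓ) :
    (liftedScheme v lab U).query θ ω i x θ j =
      ∑ b, (ω θ).val (i, (finProdFinEquiv.symm x.1.1).1, lab θ θ i (x.messageQuery hm)) b *
        U (finProdFinEquiv.symm x.1.1).2 b j := by
  classical
  rw [liftedScheme_query_of_mem θ ω i x hm, combine, Finset.sum_apply]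
  refine Finset.sum_congr rfl fun b _ => ?_
  rw [kroneckerRow_mixing_self, Matrix.single_one_vecMul]
  rfl

/-- The labels are bijective for each server, so for `θ` and `θ₀` alike the `T` servers see
combinations with independent coefficient rows, indexed by the same set. Left translation of each `ω
m` by a suitable invertible `g m` turns the queries for `θ` into those for `θ₀`. -/
theorem liftedScheme_private (hM : 2 ≤ M) (hTN : T ≤ N)
    (hv : ∀ J : Finset (Fin N), J.card = T → LinearIndependent F fun (j : J) t => v t j) :
    (liftedScheme v lab U).Private T := by
  classical
  let θ₀ : Fin M := ⟨0, by omega⟩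
  refine Scheme.private_of_law _ θ₀ fun J hJ θ y => ?_
  have hLI : ∀ θ m : Fin M, LinearIndependent F
      fun x : (Σ j : J, Fin K × MessageQuery N r M (j : Fin N) m) =>
        kroneckerRow (K := K) (q := q) (mixing v θ m x.1) (x.2.1, lab θ m x.1 x.2.2) := by
    intro θ m
    refine (linearIndependent_kroneckerRow
      (linearIndependent_mixing hTN (hv J hJ) θ m)).comp
      (fun x : (Σ j : J, Fin K × MessageQuery N r M (j : Fin N) m) =>
        (x.1, (x.2.1, lab θ m x.1 x.2.2))) ?_
    rintro ⟨j, κ, y⟩ ⟨j', κ', y'⟩ h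
    obtain ⟨h1, h2⟩ := Prod.mk.inj h
    dsimp only at h1
    subst h1
    obtain ⟨h3, h4⟩ := Prod.mk.inj h2
    dsimp only at h3 h4
    subst h3
    rw [(lab θ m j).injective h4]
  choose g hg using fun m => exists_vecMul_eq (hLI θ₀ m) (hLI θ m)
  let e : (liftedScheme v lab U).Ω ≃ (liftedScheme v lab U).Ω :=
    Equiv.piCongrRight fun m => Equiv.mulLeft (g m)
  rw [← law_comp_equiv e]
  congr 1
  funext ω i x m
  by_cases hm : m ∈ x.1.2.2
  · refine (liftedScheme_query_of_mem (U := U) (v := v) (lab := lab) θ (e ω) i x hm).trans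
      (Eq.trans ?_ (liftedScheme_query_of_mem θ₀ ω i x hm).symm)
    change combine _ (g m * ω m) _ = _
    rw [combine_mul]
    congr 1
    exact hg m ⟨i, (finProdFinEquiv.symm x.1.1).1, x.messageQuery hm⟩
  · exact (liftedScheme_query_of_notMem (U := U) (v := v) (lab := lab) θ (e ω) i x hm).trans
      (liftedScheme_query_of_notMem θ₀ ω i x hm).symm

end Lifted

end PIR
namespace PIR

/-! ### Noise, independence and correctness of the lifted scheme. -/

section LiftedProperties

variable {F : Type u} [Field F] {N K T M r q d ℓ n : ℕ}

theorem kroneckerRow_mixing_of_ne (v : Matrix (Fin T) (Fin N) F) {θ m : Fin M} (hm : m ≠ θ)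
    (i : Fin N) (p : Fin K × Fin q) : kroneckerRow (mixing v θ m i) p =
      ∑ t, v t i • kroneckerRow (fun j : Fin N => if (t : ℕ) = (j : ℕ) then 1 else 0) p := by
  funext a
  rw [Finset.sum_apply]
  by_cases hp : a.2 = p
  · simp only [kroneckerRow, if_pos hp, mixing, if_neg hm, Matrix.of_apply, Pi.smul_apply,
      smul_eq_mul]
  · simp [kroneckerRow, hp]

theorem restrictTo_apply_of_mem {S : Finset (Fin M)} {m : Fin M} (hm : m ∈ S) (x : Query F M ℓ) :
    restrictTo S x m = x m := if_pos hm

theorem restrictTo_apply_of_notMem {S : Finset (Fin M)} {m : Fin M} (hm : m ∉ S)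
    (x : Query F M ℓ) : restrictTo S x m = 0 := if_neg hm

/-- The linear functional on tensors that is given by one message. -/
def pairing (W : Fin K → Fin ℓ → F) : (Fin K → Fin ℓ → F) →ₗ[F] F where
  toFun := fun X => ∑ k, ∑ j, W k j * X k j
  map_add' := fun X Y => by simp [mul_add, Finset.sum_add_distrib]
  map_smul' := fun c X => by
    simp only [Pi.smul_apply, smul_eq_mul, Finset.mul_sum, RingHom.id_apply]
    exact Finset.sum_congr rfl fun k _ => Finset.sum_congr rfl fun j _ => mul_left_comm _ _ _

theorem eq_zero_of_pairing_eq_zero {W : Fin K → Fin ℓ → F} (h : pairing W = 0) : W = 0 := by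
  classical
  funext k j
  have h1 := LinearMap.congr_fun h (Pi.single k (Pi.single j 1))
  change ∑ k', ∑ j', W k' j' * _ = 0 at h1
  rw [Finset.sum_eq_single k, Finset.sum_eq_single j] at h1
  · simpa using h1
  · intro j' _ hj
    simp [hj]
  · simp
  · intro k' _ hk
    refine Finset.sum_eq_zero fun j' _ => ?_
    simp [hk]
  · simp

/-- Equal observations may come from different `ω`, but the queries are observed too. Hence
comparing two tuples of messages for the same `ω` suffices. -/
theorem Scheme.correct_of_injective [Fintype F] {P : Fin N → Type} [∀ i, Fintype (P i)]
    (Q : Scheme F M ℓ P) (G : Matrix (Fin K) (Fin N) F)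
    (h : ∀ θ ω (W W' : Messages F K M ℓ), (∀ i x, response G W i (Q.query θ ω i x) =
      response G W' i (Q.query θ ω i x)) → W θ = W' θ) : Q.Correct G := by
  classical
  intro θ
  refine condEntropy_eq_zero _ _ _ fun s s' hs => ?_
  obtain ⟨hans, hquery⟩ := Prod.mk.inj hs
  refine h θ s.2 s.1 s'.1 fun i x => ?_
  have h1 : response G s.1 i (Q.query θ s.2 i x) = response G s'.1 i (Q.query θ s'.2 i x) :=
    congrFun (congrFun hans i) x
  rw [h1, hquery]

variable [Fintype F] {v : Matrix (Fin T) (Fin N) F}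
  {lab : ∀ (_ m : Fin M) (i : Fin N), MessageQuery N r M i m ≃ Fin q}
  {U : Fin d → VectorIndex N K q → Fin ℓ → F}

/-- The labels of the queries about an undesired message agree on every decoding group. -/
def LabelsGroups (lab : ∀ (_ m : Fin M) (i : Fin N), MessageQuery N r M i m ≃ Fin q) : Prop :=
  ∀ θ m : Fin M, m ≠ θ → ∀ g ∈ groups N r M, ∀ (i i' : Fin N) (y : MessageQuery N r M i m)
    (y' : MessageQuery N r M i' m), (y.1.1 : ℕ) = g.2 i → (y'.1.1 : ℕ) = g.2 i' →
    y.1.2.erase θ = y'.1.2.erase θ → (y.1.2.erase θ).card = g.1 → lab θ m i y = lab θ m i' y'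

/-- The common label along the group makes the coefficient rows of the `N` servers words of `v` in
the same `T` vectors. The tuple is therefore a value of the one-shot noise. -/
theorem liftedScheme_noise (hN : 0 < N) (hlab : LabelsGroups lab) (θ : Fin M)
    (ω : (liftedScheme v lab U).Ω) (ρ : Fin (K * d)) {g : ℕ × (Fin N → ℕ)}
    (hg : g ∈ groups N r M) {S : Finset (Fin M)} (hθ : θ ∉ S) (hS : S.card = g.1)
    (x : (i : Fin N) → LiftIndex N r M (K * d) i)
    (hx : ∀ i, (x i).1.1 = ρ ∧ ((x i).1.2.1 : ℕ) = g.2 i ∧ (x i).1.2.2.erase θ = S) :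
    ∃ w : Fin T → Query F M ℓ, ∀ i,
      restrictTo S ((liftedScheme v lab U).query θ ω i (x i)) = ∑ t, v t i • w t := by
  classical
  have hmem : ∀ i, ∀ m ∈ S, m ∈ (x i).1.2.2 := fun i m hm =>
    Finset.mem_of_mem_erase ((hx i).2.2 ▸ hm)
  let i₀ : Fin N := ⟨0, hN⟩
  refine ⟨fun t m => if hm : m ∈ S then combine (U (finProdFinEquiv.symm ρ).2) (ω m)
    (kroneckerRow (fun j : Fin N => if (t : ℕ) = (j : ℕ) then 1 else 0)
      ((finProdFinEquiv.symm ρ).1, lab θ m i₀ ((x i₀).messageQuery (hmem i₀ m hm)))) else 0,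
    fun i => funext fun m => ?_⟩
  rw [Finset.sum_apply]
  simp only [Pi.smul_apply]
  by_cases hm : m ∈ S
  · have hmθ : m ≠ θ := fun h => hθ (h ▸ hm)
    have hl : lab θ m i ((x i).messageQuery (hmem i m hm)) =
        lab θ m i₀ ((x i₀).messageQuery (hmem i₀ m hm)) :=
      hlab θ m hmθ g hg i i₀ _ _ (hx i).2.1 (hx i₀).2.1 ((hx i).2.2.trans (hx i₀).2.2.symm)
        ((congrArg Finset.card (hx i).2.2).trans hS)
    rw [restrictTo_apply_of_mem hm, liftedScheme_query_of_mem θ ω i _ (hmem i m hm), hl,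
      (hx i).1, kroneckerRow_mixing_of_ne v hmθ, combine_sum_smul]
    exact Finset.sum_congr rfl fun t _ => by rw [dif_pos hm]
  · rw [restrictTo_apply_of_notMem hm]
    symm
    exact Finset.sum_eq_zero fun t _ => by rw [dif_neg hm, smul_zero]

theorem liftedScheme_independent {G : Matrix (Fin K) (Fin N) F}
    (hU : ∀ γ : (Matrix (VectorIndex N K q) (VectorIndex N K q) F)ˣ,
      LinearIndependent F fun (p : Fin d × VectorIndex N K q) (k : Fin K) j =>
        G k p.2.1 * ∑ b, γ.val p.2 b * U p.1 b j)
    (θ : Fin M) (ω : (liftedScheme v lab U).Ω) :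
    LinearIndependent F
      (fun (x : {x : Σ i : Fin N, LiftIndex N r M (K * d) i // θ ∈ x.2.1.2.2})
        (W : Messages F K M ℓ) =>
          response G W x.1.1 (restrictTo {θ} ((liftedScheme v lab U).query θ ω x.1.1 x.1.2))) := by
  have key : LinearIndependent F
      fun (x : {x : Σ i : Fin N, LiftIndex N r M (K * d) i // θ ∈ x.2.1.2.2}) (k : Fin K) j =>
        G k x.1.1 * (restrictTo {θ} ((liftedScheme v lab U).query θ ω x.1.1 x.1.2)) θ j := by
    have h := (hU (ω θ)).comp
      (fun x : {x : Σ i : Fin N, LiftIndex N r M (K * d) i // θ ∈ x.2.1.2.2} =>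
        ((finProdFinEquiv.symm x.1.2.1.1).2, (x.1.1, (finProdFinEquiv.symm x.1.2.1.1).1,
          lab θ θ x.1.1 (x.1.2.messageQuery x.2)))) ?_
    · convert h using 1
      funext x k j
      rw [restrictTo_apply_of_mem (Finset.mem_singleton_self θ),
        liftedScheme_query_desired θ ω _ _ x.2]
      rfl
    · rintro ⟨⟨i, x⟩, hx⟩ ⟨⟨i', x'⟩, hx'⟩ h
      simp only [Prod.mk.injEq] at h
      obtain ⟨h1, h2, h3, h4⟩ := h
      subst h2
      have h5 : x.1.1 = x'.1.1 := finProdFinEquiv.symm.injective (Prod.ext h3 h1)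
      have h6 := congrArg Subtype.val ((lab θ θ i).injective h4)
      have h7 : x = x' := Subtype.ext (Prod.ext h5 h6)
      subst h7
      rfl
  exact linearIndependent_response G θ _ _
    (fun x m hm => restrictTo_apply_of_notMem (by simpa using hm) _) key

/-- If all answers vanish, then so do the responses to the desired components: the noise in them
is determined by the queries of the decoding groups that do not involve the desired message. -/
theorem response_desired_eq_zero (hr : r ≤ N) (hn : n = N - r) (hM : 2 ≤ M)
    (hlab : LabelsGroups lab) {G : Matrix (Fin K) (Fin N) F} {h : Matrix (Fin n) (Fin N) F}
    (hh : ∀ s : Fin n ↪ Fin N, (h.submatrix id s).det ≠ 0)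
    (hv : ∀ t k a, ∑ j, G k j * h a j * v t j = 0)
    (θ : Fin M) (ω : (liftedScheme v lab U).Ω) (W : Messages F K M ℓ)
    (hW : ∀ i x, response G W i ((liftedScheme v lab U).query θ ω i x) = 0)
    (i : Fin N) (x : LiftIndex N r M (K * d) i) (hx : θ ∈ x.1.2.2) :
    response G W i (restrictTo {θ} ((liftedScheme v lab U).query θ ω i x)) = 0 := by
  have hsplit : restrictTo {θ} ((liftedScheme v lab U).query θ ω i x) +
      restrictTo (x.1.2.2.erase θ) ((liftedScheme v lab U).query θ ω i x) =
      (liftedScheme v lab U).query θ ω i x := by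
    funext m
    rw [Pi.add_apply]
    by_cases hm : m = θ
    · subst hm
      rw [restrictTo_apply_of_mem (Finset.mem_singleton_self m),
        restrictTo_apply_of_notMem (Finset.notMem_erase m _), add_zero]
    · rw [restrictTo_apply_of_notMem (by simpa using hm), zero_add]
      by_cases hmx : m ∈ x.1.2.2
      · rw [restrictTo_apply_of_mem (Finset.mem_erase.2 ⟨hm, hmx⟩)]
      · rw [restrictTo_apply_of_notMem fun h => hmx (Finset.mem_of_mem_erase h),
          liftedScheme_query_of_notMem θ ω i x hmx]
  have hrest : response G W i
      (restrictTo (x.1.2.2.erase θ) ((liftedScheme v lab U).query θ ω i x)) = 0 := by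
    rcases (x.1.2.2.erase θ).eq_empty_or_nonempty with h0 | ⟨m, hm⟩
    · rw [h0]
      have : restrictTo ∅ ((liftedScheme v lab U).query θ ω i x) = 0 :=
        funext fun m => restrictTo_apply_of_notMem (Finset.notMem_empty m) _
      rw [this, response_zero]
    · obtain ⟨hmθ, hmx⟩ := Finset.mem_erase.1 hm
      obtain ⟨g, hg, hrow, hk⟩ := exists_group hr hM hmθ i (x.messageQuery hmx)
      let p : NoiseTuple N r M θ m :=
        ⟨(g, x.1.2.2.erase θ), hg, Finset.notMem_erase θ _, hk, hm⟩
      -- The queries of all servers that belong to the group and the set of `x`, in the round of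
      -- `x`.
      let X : (i : Fin N) → LiftIndex N r M (K * d) i := fun i' =>
        ⟨(x.1.1, (p.query hr hM i').1), (p.query hr hM i').2.1⟩
      have hXi : X i = x := by
        have h1 : p.query hr hM i = x.messageQuery hmx := p.query_eq hr hM i _ hrow.symm rfl
        have h2 := congrArg Subtype.val h1
        exact Subtype.ext (Prod.ext rfl h2)
      obtain ⟨w, hw⟩ := liftedScheme_noise (U := U) (v := v) (S := x.1.2.2.erase θ) i.pos
        hlab θ ω x.1.1 hg
        (Finset.notMem_erase θ _) hk X fun i' => ⟨rfl, rfl, p.query_erase hr hM i'⟩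
      -- At the `r` noise entries the query consists of noise alone, so the response vanishes. The
      -- vector of noise responses is thus supported on the `n` mixed entries and killed by `h`,
      -- hence zero.
      have hz := eq_zero_of_minors h hh
        (Finset.univ.filter fun i' => (symbolicMatrix N r M).getD (g.2 i') 0 i' = g.1 + 1) (by
          obtain ⟨M, rfl⟩ := Nat.exists_eq_add_of_le' hM
          rw [Finset.card_filter, (isGrouping_symbolicMatrix hr M).sum_mixed g hg, Fintype.card_fin,
            hn])
        (fun i' => response G W i' (∑ t, v t i' • w t))
        (fun a => sum_check_mul_response hv W w a) (fun i' hi' => by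
          have hval : (symbolicMatrix N r M).getD (g.2 i') 0 i' = g.1 := by
            obtain ⟨M, rfl⟩ := Nat.exists_eq_add_of_le' hM
            exact ((isGrouping_symbolicMatrix hr M).value g hg i').resolve_right
              fun h => hi' (Finset.mem_filter.2 ⟨Finset.mem_univ _, h⟩)
          have hset : (X i').1.2.2 = x.1.2.2.erase θ := if_pos hval
          have hfull : restrictTo (x.1.2.2.erase θ)
              ((liftedScheme v lab U).query θ ω i' (X i')) =
              (liftedScheme v lab U).query θ ω i' (X i') := by
            funext m'
            by_cases hm' : m' ∈ x.1.2.2.erase θ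
            · exact restrictTo_apply_of_mem hm' _
            · rw [restrictTo_apply_of_notMem hm',
                liftedScheme_query_of_notMem θ ω i' (X i') (hset ▸ hm')]
          rw [← hw i', hfull]
          exact hW i' (X i'))
      have h3 : response G W i (∑ t, v t i • w t) = 0 := congrFun hz i
      rw [← hw i, hXi] at h3
      exact h3
  have hsum := hW i x
  rw [← hsplit, response_add, hrest, add_zero] at hsum
  exact hsum

/-- By linearity it suffices that vanishing answers force the desired message to vanish. The number
of tensors equals the dimension `K ℓ`, so being independent they span, and a message that pairs to
zero with all of them is zero. -/
theorem liftedScheme_correct (hr : r ≤ N) (hn : n = N - r) (hM : 2 ≤ M) (hℓ : ℓ = d * (N * q))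
    (hlab : LabelsGroups lab) {G : Matrix (Fin K) (Fin N) F} {h : Matrix (Fin n) (Fin N) F}
    (hh : ∀ s : Fin n ↪ Fin N, (h.submatrix id s).det ≠ 0)
    (hv : ∀ t k a, ∑ j, G k j * h a j * v t j = 0)
    (hU : ∀ γ : (Matrix (VectorIndex N K q) (VectorIndex N K q) F)ˣ,
      LinearIndependent F fun (p : Fin d × VectorIndex N K q) (k : Fin K) j =>
        G k p.2.1 * ∑ b, γ.val p.2 b * U p.1 b j) :
    (liftedScheme v lab U).Correct G := by
  refine Scheme.correct_of_injective _ G fun θ ω W W' hWW' => ?_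
  rw [← sub_eq_zero]
  have hW : ∀ i x, response G (W - W') i ((liftedScheme v lab U).query θ ω i x) = 0 := by
    intro i x
    rw [response_sub_left, hWW', sub_self]
  refine eq_zero_of_pairing_eq_zero (W := (W - W') θ) ?_
  have hspan := (hU (ω θ)).span_eq_top_of_card_eq_finrank' (by
    rw [Module.finrank_pi_fintype]
    simp [hℓ]
    ring)
  refine LinearMap.ext_on hspan ?_
  rintro _ ⟨⟨δ, i, κ, z⟩, rfl⟩
  let y := (lab θ θ i).symm z
  -- Every tensor of the basis comes from an actual query, because the label is surjective.
  let x : LiftIndex N r M (K * d) i := ⟨(finProdFinEquiv (κ, δ), y.1), y.2.1⟩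
  have hx : θ ∈ x.1.2.2 := y.2.2
  have h2 := response_desired_eq_zero hr hn hM hlab hh hv θ ω (W - W') hW i x hx
  rw [response_of_support _ _ fun m hm => restrictTo_apply_of_notMem (by simpa using hm) _] at h2
  simp only [restrictTo_apply_of_mem (Finset.mem_singleton_self θ),
    liftedScheme_query_desired θ ω i x hx] at h2
  have h3 : x.messageQuery hx = y := rfl
  rw [h3] at h2
  simp only [x, y, Equiv.symm_apply_apply, Equiv.apply_symm_apply] at h2
  exact h2

end LiftedProperties

end PIR
namespace PIR

/-! ### The rate. -/

section Rate

theorem sum_card_liftIndex {N r M c : ℕ} (hr : r ≤ N) (hM : 2 ≤ M) :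
    (N - r) * (∑ i, Fintype.card (LiftIndex N r M c i)) + c * r ^ M = c * N ^ M := by
  have h : ∀ i, Fintype.card (LiftIndex N r M c i) =
      c * Nat.card {y : Fin (symbolicMatrix N r M).length × Finset (Fin M) //
        IsRoundQuery i y} := by
    intro i
    let e : LiftIndex N r M c i ≃
        Fin c × {y : Fin (symbolicMatrix N r M).length × Finset (Fin M) // IsRoundQuery i y} :=
      { toFun := fun x => (x.1.1, ⟨x.1.2, x.2⟩)
        invFun := fun p => ⟨(p.1, p.2.1), p.2.2⟩
        left_inv := fun _ => rfl
        right_inv := fun _ => rfl }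
    rw [← Nat.card_eq_fintype_card, Nat.card_congr e, Nat.card_prod, Nat.card_fin]
  simp only [h]
  rw [← Finset.mul_sum, ← sum_card_roundQuery hr hM]
  ring

/-- The rate of a scheme with the query structure of the symbolic matrix. -/
theorem rate_liftIndex {F : Type u} [Field F] {N K T M r d : ℕ} (hK : 1 ≤ K) (hTN : T < N)
    (hM : 2 ≤ M) (hd : 0 < d) (hr : r ≤ N) (hT : K * (N - r) + T = N)
    (Q : Scheme F M (d * (N * N ^ (M - 2))) (LiftIndex N r M (K * d))) :
    Q.rate K = ((N : ℝ) - T) * ((N : ℝ) * K) ^ (M - 1) /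
      (((N : ℝ) * K) ^ M - ((N : ℝ) * K - N + T) ^ M) := by
  have hn : 0 < N - r := by
    rcases Nat.eq_zero_or_pos (N - r) with h | h
    · rw [h, mul_zero] at hT
      omega
    · exact h
  have hcount := sum_card_liftIndex (c := K * d) hr hM
  unfold Scheme.rate
  set R := ∑ i, Fintype.card (LiftIndex N r M (K * d) i) with hR
  have hpow : r ^ M < N ^ M := Nat.pow_lt_pow_left (by omega) (by omega)
  have hRpos : 0 < R := by
    rcases Nat.eq_zero_or_pos R with h | h
    · rw [h, mul_zero, zero_add] at hcount
      have := Nat.eq_of_mul_eq_mul_left (Nat.mul_pos hK hd) hcount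
      omega
    · exact h
  have hcountR : ((N : ℝ) - r) * R + (K * d) * (r : ℝ) ^ M = (K * d) * (N : ℝ) ^ M := by
    rw [← Nat.cast_sub hr]
    exact_mod_cast hcount
  have hTR : (K : ℝ) * ((N : ℝ) - r) + T = N := by
    rw [← Nat.cast_sub hr]
    exact_mod_cast hT
  have hKR : (0 : ℝ) < K := by exact_mod_cast hK
  have hdR : (0 : ℝ) < d := by exact_mod_cast hd
  have hRR : (0 : ℝ) < R := by exact_mod_cast hRpos
  have hpowR : (r : ℝ) ^ M < (N : ℝ) ^ M := by exact_mod_cast hpow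
  -- These substitutions reduce the claim to the rate `(N - r) N ^ (M - 1) / (N ^ M - r ^ M)`.
  have h1 : (N : ℝ) - T = K * (N - r) := by linarith
  have h2 : (N : ℝ) * K - N + T = r * K := by linarith
  rw [h1, h2, mul_pow, mul_pow, mul_pow, ← sub_mul]
  obtain ⟨M, rfl⟩ := Nat.exists_eq_add_of_le' hM
  have hden : 0 < ((N : ℝ) ^ (M + 2) - (r : ℝ) ^ (M + 2)) * (K : ℝ) ^ (M + 2) :=
    mul_pos (sub_pos.2 hpowR) (pow_pos hKR _)
  rw [show M + 2 - 1 = M + 1 by omega, show M + 2 - 2 = M by omega,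
    div_eq_div_iff hRR.ne' hden.ne']
  push_cast
  have h3 : (K * d) * ((N : ℝ) ^ (M + 2) - (r : ℝ) ^ (M + 2)) = ((N : ℝ) - r) * R := by
    linarith
  calc (K : ℝ) * (d * (N * N ^ M)) * (((N : ℝ) ^ (M + 2) - (r : ℝ) ^ (M + 2)) * K ^ (M + 2))
      = N ^ (M + 1) * K ^ (M + 2) * ((K * d) * ((N : ℝ) ^ (M + 2) - (r : ℝ) ^ (M + 2))) := by ring
    _ = N ^ (M + 1) * K ^ (M + 2) * (((N : ℝ) - r) * R) := by rw [h3]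
    _ = _ := by ring

end Rate

end PIR

/-! ### The main theorem. -/

theorem mainTheorem5 (N K T M r : ℕ) (hK : 1 ≤ K) (hT : 1 ≤ T) (hTN : T < N) (hM : 2 ≤ M)
    (hr : (r : ℚ) = ((N : ℚ) * K - N + T) / K) :
    ∃ q₀ : ℕ, ∀ (F : Type u) [Field F] [Fintype F], q₀ ≤ Fintype.card F →
      ∀ G : Matrix (Fin K) (Fin N) F, PIR.IsMDS G →
        ∃ (ℓ c : ℕ) (O : PIR.OneShotScheme G T M r ℓ)
          (Q : PIR.Scheme F M ℓ (PIR.LiftIndex N r M c)),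
          PIR.IsRefinedLift O Q ∧ PIR.IsPIRScheme G T Q ∧
          Q.rate K = ((N : ℝ) - T) * ((N : ℝ) * K) ^ (M - 1) /
            (((N : ℝ) * K) ^ M - ((N : ℝ) * K - N + T) ^ M) := by
  have hN : 0 < N := by omega
  have hrK : r * K + N = N * K + T := by
    have hK0 : (K : ℚ) ≠ 0 := by exact_mod_cast (by omega : K ≠ 0)
    rw [eq_div_iff hK0] at hr
    have h : (r : ℚ) * K + N = N * K + T := by rw [hr]; ring
    exact_mod_cast h
  -- Otherwise `r * K ≥ N * K + K`, which contradicts `hrK` as `T < N`.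
  have hrN : r ≤ N := by
    by_contra! h
    nlinarith
  have hsum : K * (N - r) + T = N := by
    have h1 : K * (N - r) + K * r = K * N := by rw [← mul_add, Nat.sub_add_cancel hrN]
    have h2 := mul_comm r K
    have h3 := mul_comm N K
    omega
  obtain ⟨q₀, hq₀⟩ := PIR.exists_noise_code.{u} N K T (N - r) hsum
  refine ⟨q₀, fun F _ _ hF G hG => ?_⟩
  obtain ⟨h, v, hh, hv, hvJ⟩ := hq₀ F hF G hG
  obtain ⟨coeff, hcoeff⟩ := PIR.exists_decoding_coeff (Nat.add_sub_cancel' hrN) hh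
  obtain ⟨d, U, hd, hU⟩ := PIR.exists_generic_vectors hG (N ^ (M - 2))
  choose lab hlab using PIR.exists_label hN hrN hM
  have hℓ : N ≤ d * (N * N ^ (M - 2)) := by
    have h1 : 0 < N ^ (M - 2) := pow_pos hN _
    calc N = 1 * (N * 1) := by ring
      _ ≤ d * (N * N ^ (M - 2)) := Nat.mul_le_mul hd (Nat.mul_le_mul_left N h1)
  refine ⟨d * (N * N ^ (M - 2)), K * d, PIR.oneShotScheme hG hK hℓ hv hvJ coeff hcoeff,
    PIR.liftedScheme v lab U, ⟨?_, ?_, ?_⟩, ⟨hG, ?_, ?_⟩, ?_⟩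
  · intro θ ω _ i x m hm
    exact PIR.liftedScheme_query_of_notMem θ ω i x hm
  · intro θ ω _
    exact PIR.liftedScheme_independent hU θ ω
  · intro θ ω _ ρ g hg S hθ hS x hx
    obtain ⟨w, hw⟩ := PIR.liftedScheme_noise hN hlab θ ω ρ hg hθ hS x hx
    exact ⟨w, inv_pos.2 (by exact_mod_cast Fintype.card_pos), hw⟩
  · exact PIR.liftedScheme_correct hrN rfl hM rfl hlab hh hv hU
  · exact PIR.liftedScheme_private hM hTN.le hvJ
  · exact PIR.rate_liftIndex hK hTN hM hd hrN hsum _
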